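/- Let $G=(V,E)$ be a finite simple graph on $V=[d]=\{1,\dots,d\}$ and let $\widetilde E := E\cup\{\{j\}: j\in V\}$. The change points $\lambda_1,\dots,\lambda_d$ are independent, $\lambda_j$ being geometric with parameter $\rho_j\in(0,1)$, i.e. $\mathbb P(\lambda_j=k)=(1-\rho_j)^{k-1}\rho_j$ for $k=1,2,\dots$. For $e\in\widetilde E$ let $\lambda_e:=\min_{j\in e}\lambda_j$, and let $g_e,f_e$ be probability densities with respect to a common measure $\mu$. Conditionally on $(\lambda_1,\dots,\lambda_d)$, the observations $X_e^t$ ($e\in\widetilde E$, $t=1,2,\dots$) are independent, $X_e^t$ having density $g_e$ if $t<\lambda_e$ and $f_e$ if $t\ge\lambda_e$. Let $\mathcal F_n$ be the $\sigma$-algebra generated by $X_e^t$, $e\in\widetilde E$, $1\le t\le n$. Fix a non-empty $\mathcal S\subset[d]$ and let $\lambda_{\mathcal S}:=\min_{j\in\mathcal S}\lambda_j$. Put $$I_e:=\int f_e\log\frac{f_e}{g_e}\,d\mu,\qquad I_{\lambda_{\mathcal S}}:=\sum_{e\in\widetilde E,\ e\subset\mathcal S}I_e,\qquad q_{\lambda_{\mathcal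 S}}:=-\log\prod_{j\in\mathcal S}(1-\rho_j).$$ For $\alpha\in(0,1)$ let $\tau_{\mathcal S}:=\inf\{n\ge1:\ \mathbb P(\lambda_{\mathcal S}\le n\mid\mathcal F_n)\ge1-\alpha\}$, and let $\Delta(\alpha)$ be the set of all stopping times $\tau$ (with values in $\{0,1,2,\dots\}\cup\{\infty\}$) of the filtration $(\mathcal F_n)_{n\ge0}$ with false-alarm probability $\mathbb P(\tau<\lambda_{\mathcal S})\le\alpha$. **Theorem (optimal delay).** Assume that there is a constant $M$ such that $\|\log (f_e/g_e)\|_\infty\le M$ for all $e\in\widetilde E$ (where $f_e$ and $g_e$ have the same support up to $\mu$-null sets and the ratio is taken there). Then $\tau_{\mathcal S}\in\Delta(\alpha)$ for every $\alpha\in(0,1)$, and $\tau_{\mathcal S}$ is asymptotically optimal for $\lambda_{\mathcal S}$: as $\alpha\downarrow0$, $$\mathbb E\big[\tau_{\mathcal S}-\lambda_{\mathcal S}\mid\tau_{\mathcal S}\ge\lambda_{\mathcal S}\big]=\frac{|\log\alpha|}{q_{\lambda_{\mathcal S}}+I_{\lambda_{\mathcal S}}}\,(1+o(1))$$ and $$\inf_{\tau\in\Delta(\alpha)}\mathbb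 E\big[\tau-\lambda_{\mathcal S}\mid\tau\ge\lambda_{\mathcal S}\big]=\frac{|\log\alpha|}{q_{\lambda_{\mathcal S}}+I_{\lambda_{\mathcal S}}}\,(1+o(1)).$$ The second asymptotic relation also holds when $\Delta(\alpha)$ is replaced by the smaller class of stopping times with $\mathbb P(\tau\le\lambda_{\mathcal S})\le\alpha$. -/

import Mathlib

open MeasureTheory ProbabilityTheory Filter
open scoped ENNReal Topology

/-- The extended edge set of a graph on `[d]`: all singletons `{j}` (the private data of node `j`)
and all edges `{i, j}` of the graph. -/
noncomputable def extEdges {d : ℕ} (G : SimpleGraph (Fin d)) : Finset (Finset (Fin d)) :=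
  open Classical in
  Finset.univ.filter fun e => (∃ j, e = {j}) ∨ ∃ i j, G.Adj i j ∧ e = {i, j}

/-- `minOver S m` is the minimum of `m j` over `j ∈ S`. -/
noncomputable def minOver {d : ℕ} (S : Finset (Fin d)) (m : Fin d → ℕ) : ℕ∞ :=
  S.inf fun j => (m j : ℕ∞)

/-- `p` is a probability density with respect to `μ`. -/
structure IsProbDensity {𝒳 : Type*} [MeasurableSpace 𝒳] (μ : Measure 𝒳) (p : 𝒳 → ℝ) : Prop where
  measurable : Measurable p
  nonneg : ∀ x, 0 ≤ p x
  lintegral_eq_one : ∫⁻ x, ENNReal.ofReal (p x) ∂μ = 1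

/-- The weights of the geometric distribution on `{1, 2, …}` with parameter `ρ`. -/
def geomWeight (ρ : ℝ) (k : ℕ) : ℝ :=
  if k = 0 then 0 else (1 - ρ) ^ (k - 1) * ρ

/-- Parameters of the network change point model: the statistical graph, the parameters `ρ j` of the
geometric priors, the underlying measure `μ`, and for each extended edge `e` the pre-change density
`g e` and the post-change density `f e`.  The values of `f e`, `g e` for an `e` that is not an
extended edge play no role. -/
structure ChangePointNetwork (d : ℕ) (𝒳 : Type*) [MeasurableSpace 𝒳] where
  graph : SimpleGraph (Fin d)
  ρ : Fin d → ℝ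
  ρ_pos : ∀ j, 0 < ρ j
  ρ_lt_one : ∀ j, ρ j < 1
  μ : Measure 𝒳
  g : Finset (Fin d) → 𝒳 → ℝ
  f : Finset (Fin d) → 𝒳 → ℝ
  g_density : ∀ e ∈ extEdges graph, IsProbDensity μ (g e)
  f_density : ∀ e ∈ extEdges graph, IsProbDensity μ (f e)

namespace ChangePointNetwork

variable {d : ℕ} {𝒳 : Type*} [MeasurableSpace 𝒳] (N : ChangePointNetwork d 𝒳)

/-- The log-likelihood ratios `log (f e / g e)` are bounded by `M` in absolute value, for every node
and every edge.  The densities `f e` and `g e` have the same support, and the ratio is considered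
there. -/
def BoundedLLR (M : ℝ) : Prop :=
  ∀ e ∈ extEdges N.graph, ∀ᵐ x ∂N.μ,
    (N.f e x = 0 ∧ N.g e x = 0) ∨
      (0 < N.f e x ∧ 0 < N.g e x ∧ |Real.log (N.f e x / N.g e x)| ≤ M)

/-- The Kullback-Leibler divergence between `f e` and `g e`. -/
noncomputable def info (e : Finset (Fin d)) : ℝ :=
  ∫ x, N.f e x * Real.log (N.f e x / N.g e x) ∂N.μ

/-- The total information of `S`: the sum over the extended edges contained in `S`. -/
noncomputable def totalInfo (S : Finset (Fin d)) : ℝ :=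
  ∑ e ∈ (extEdges N.graph).filter (· ⊆ S), N.info e

/-- The exponential rate `q` of the geometric prior of `min_{j ∈ S} λ_j`, that is
`1 - exp (-q) = 1 - ∏ j ∈ S, (1 - ρ j)`. -/
noncomputable def priorRate (S : Finset (Fin d)) : ℝ :=
  -Real.log (∏ j ∈ S, (1 - N.ρ j))

/-- Change points `lam j` and observations `X e t` (`e` an extended edge, `t = 1, 2, …`), defined on a
common probability space, follow the network model: the joint distribution of
`lam` and of the observations up to time `n` is the product of the priors and of the
conditional likelihoods, in which `X e t` has density `g e` for `t < λ_e` and `f e` for `t ≥ λ_e`,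
where `λ_e` is the minimum of the change points over `e`. -/
structure IsRealization {Ω : Type*} [MeasurableSpace Ω] (P : Measure Ω)
    (lam : Fin d → Ω → ℕ) (X : Finset (Fin d) → ℕ → Ω → 𝒳) : Prop where
  measurable_lam : ∀ j, Measurable (lam j)
  measurable_obs : ∀ e ∈ extEdges N.graph, ∀ t, 1 ≤ t → Measurable (X e t)
  joint_law : ∀ (m : Fin d → ℕ) (n : ℕ) (B : Finset (Fin d) → ℕ → Set 𝒳),
    (∀ e t, MeasurableSet (B e t)) →
    P {ω | (∀ j, lam j ω = m j) ∧
        ∀ e ∈ extEdges N.graph, ∀ t ∈ Finset.Icc 1 n, X e t ω ∈ B e t} =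
      (∏ j, ENNReal.ofReal (geomWeight (N.ρ j) (m j))) *
        ∏ e ∈ extEdges N.graph, ∏ t ∈ Finset.Icc 1 n,
          ∫⁻ x in B e t,
            ENNReal.ofReal (if (t : ℕ∞) < minOver e m then N.g e x else N.f e x) ∂N.μ

variable {Ω : Type*} [mΩ : MeasurableSpace Ω] {N} {P : Measure Ω}
  {lam : Fin d → Ω → ℕ} {X : Finset (Fin d) → ℕ → Ω → 𝒳}

namespace IsRealization

/-- The filtration `F n` generated by all the observations in the network up to time `n`. -/
def obsFiltration (h : N.IsRealization P lam X) : Filtration ℕ mΩ where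
  seq n := ⨆ e ∈ extEdges N.graph, ⨆ t ∈ Finset.Icc 1 n, MeasurableSpace.comap (X e t) inferInstance
  mono' _ _ hab := iSup₂_mono fun _ _ => biSup_mono fun _ ht =>
    Finset.Icc_subset_Icc_right hab ht
  le' _ := iSup₂_le fun e he => iSup₂_le fun t ht =>
    (h.measurable_obs e he t (Finset.mem_Icc.mp ht).1).comap_le

/-- The functional `φ = λ_S = min_{j ∈ S} λ_j`. -/
noncomputable def phi (_h : N.IsRealization P lam X) (S : Finset (Fin d)) (ω : Ω) : ℕ∞ :=
  minOver S fun j => lam j ω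

/-- The posterior probability of `{λ_S ≤ n}` given the observations up to time `n`. -/
noncomputable def posterior (h : N.IsRealization P lam X) (S : Finset (Fin d)) (n : ℕ) : Ω → ℝ :=
  P[Set.indicator {ω | h.phi S ω ≤ n} (fun _ => (1 : ℝ)) | h.obsFiltration n]

/-- The posterior-threshold rule `τ_S`: the first `n ≥ 1` at which the posterior probability of
`{λ_S ≤ n}` is at least `1 - α` (and `∞` if there is none). -/
noncomputable def thresholdRule (h : N.IsRealization P lam X) (S : Finset (Fin d)) (α : ℝ)
    (ω : Ω) : ℕ∞ :=
  ⨅ (n : ℕ) (_ : 1 ≤ n ∧ 1 - α ≤ h.posterior S n ω), (n : ℕ∞)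

/-- The sequential rules `τ` (stopping times) with `ℙ(τ < λ_S) ≤ α`. -/
def ruleClass (h : N.IsRealization P lam X) (S : Finset (Fin d)) (α : ℝ) : Set (Ω → ℕ∞) :=
  {τ | IsStoppingTime h.obsFiltration τ ∧ P {ω | τ ω < h.phi S ω} ≤ ENNReal.ofReal α}

/-- The sequential rules `τ` (stopping times) with `ℙ(τ ≤ λ_S) ≤ α`. -/
def ruleClassLE (h : N.IsRealization P lam X) (S : Finset (Fin d)) (α : ℝ) : Set (Ω → ℕ∞) :=
  {τ | IsStoppingTime h.obsFiltration τ ∧ P {ω | τ ω ≤ h.phi S ω} ≤ ENNReal.ofReal α}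

/-- The conditional expected delay `𝔼[τ - λ_S | τ ≥ λ_S]`, with values in `[0, ∞]`. -/
noncomputable def delay (h : N.IsRealization P lam X) (S : Finset (Fin d)) (τ : Ω → ℕ∞) : ℝ≥0∞ :=
  ∫⁻ ω, ((τ ω - h.phi S ω : ℕ∞) : ℝ≥0∞) ∂(P[|{ω | h.phi S ω ≤ τ ω}])

end IsRealization

end ChangePointNetwork

/-! Write `q` for the prior rate of `S`, `I` for its total information and `D = q + I`. Both bounds
rest on one symmetry. By memorylessness of the geometric prior, conditioning on no change in `S` up
to time `n` amounts to delaying the change points in `S` by `n` and paying a factor `exp (-q n)`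
(`tsum_priorWeight_shift`). Everything is conditioned on the countably many values of the vector
`lam`. Given that vector the observations are independent, and different configurations are compared
through explicit products of likelihood ratios (`lintegral_exp_logLik_mul`).

Lower bound. Let `score` collect the log-likelihood ratios of those observations whose law the delay
changes. On `n`-measurable events the delay identity reads `E[exp (-(q n + score_n)); A] = P(A, n <
λ_S)` (`lintegral_exp_score`), and summing over the values of a stopping time gives `E[exp (-(q τ +
score_τ)); τ < ∞] ≤ P(τ < λ_S) ≤ α`. The inequality `1 + x ≤ exp x` turns this into a lower bound
for `E[q τ + score_τ]`. Wald's identity replaces `score` by its compensator, and the compensated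
exponent differs from `D (τ - λ_S)⁺` by at most a constant times `1 + ∑ λ_j`, which is integrable
(`abs_scoreComp_sub_le`). Hence `D E(τ - λ_S)⁺ ≥ |log α| - const` for every admissible `τ`.

Upper bound. Before the threshold rule stops, the marginal likelihood of no change in `S` is at
least `α` times the total one (`ofReal_mul_mixLik_le`). The total is at least the contribution of
the true configuration. The no-change part factors as `exp (-q n - score)` times the true likelihood
times `mixOut`, where `score` now uses only the observations inside `S` (`mixLik_not_changed_eq`).
`mixOut` is a mixture of likelihood-ratio martingales and has mean at most one at bounded stopping
times (`lintegral_mixOut_le`). Since `log y ≤ y - 1`, it costs only a constant in expectation, and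
Wald's identity gives `D E(τ_S - λ_S)⁺ ≤ |log α| + const`.

Conditioning on no false alarm changes the delay by a factor between `1` and `1 / (1 - α)`, and a
squeeze finishes. For the class with `P(τ ≤ λ_S) ≤ α` the rule `τ_S + 1` is used, at the cost of one
time unit. -/

theorem coe_lt_minOver_iff {d : ℕ} (e : Finset (Fin d)) (m : Fin d → ℕ) (t : ℕ) :
    (t : ℕ∞) < minOver e m ↔ ∀ j ∈ e, t < m j := by
  rw [minOver, Finset.lt_inf_iff (ENat.natCast_lt_top t)]
  simp

theorem geomWeight_nonneg {ρ : ℝ} (h0 : 0 < ρ) (h1 : ρ < 1) (k : ℕ) : 0 ≤ geomWeight ρ k := by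
  unfold geomWeight
  split_ifs
  · exact le_rfl
  · have : 0 ≤ 1 - ρ := by linarith
    positivity

theorem geomWeight_pos {ρ : ℝ} (h0 : 0 < ρ) (h1 : ρ < 1) {k : ℕ} (hk : 1 ≤ k) :
    0 < geomWeight ρ k := by
  have : 0 < 1 - ρ := by linarith
  rw [geomWeight, if_neg (by omega)]
  positivity

/-! ### Conditional laws of the observations given the change points. -/

namespace ChangePointNetwork

variable {d : ℕ} {𝒳 : Type*} [MeasurableSpace 𝒳] (N : ChangePointNetwork d 𝒳)

/-- The prior probability of the configuration `m` of change points. -/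
noncomputable def priorWeight (m : Fin d → ℕ) : ℝ := ∏ j, geomWeight (N.ρ j) (m j)

theorem priorWeight_pos {m : Fin d → ℕ} (hm : ∀ j, 1 ≤ m j) : 0 < N.priorWeight m :=
  Finset.prod_pos fun j _ => geomWeight_pos (N.ρ_pos j) (N.ρ_lt_one j) (hm j)

theorem one_le_of_priorWeight_ne_zero {m : Fin d → ℕ} (hm : N.priorWeight m ≠ 0) (j : Fin d) :
    1 ≤ m j := by
  by_contra hj
  refine hm (Finset.prod_eq_zero (Finset.mem_univ j) ?_)
  rw [geomWeight, if_pos (by omega)]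

/-- The law of the observation `X e t` given the change points `m`. -/
noncomputable def obsLaw (m : Fin d → ℕ) (e : Finset (Fin d)) (t : ℕ) : Measure 𝒳 :=
  N.μ.withDensity fun x => ENNReal.ofReal (if (t : ℕ∞) < minOver e m then N.g e x else N.f e x)

theorem obsLaw_of_lt {m : Fin d → ℕ} {e : Finset (Fin d)} {t : ℕ} (h : (t : ℕ∞) < minOver e m) :
    N.obsLaw m e t = N.μ.withDensity fun x => ENNReal.ofReal (N.g e x) := by
  simp [obsLaw, h]

theorem obsLaw_of_not_lt {m : Fin d → ℕ} {e : Finset (Fin d)} {t : ℕ}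
    (h : ¬ (t : ℕ∞) < minOver e m) :
    N.obsLaw m e t = N.μ.withDensity fun x => ENNReal.ofReal (N.f e x) := by
  simp [obsLaw, h]

variable {N} in
theorem isProbabilityMeasure_obsLaw {e : Finset (Fin d)} (he : e ∈ extEdges N.graph)
    (m : Fin d → ℕ) (t : ℕ) : IsProbabilityMeasure (N.obsLaw m e t) := by
  constructor
  by_cases h : (t : ℕ∞) < minOver e m
  · rw [N.obsLaw_of_lt h]
    simpa using (N.g_density e he).lintegral_eq_one
  · rw [N.obsLaw_of_not_lt h]
    simpa using (N.f_density e he).lintegral_eq_one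

namespace IsRealization

variable {Ω : Type*} [mΩ : MeasurableSpace Ω] {N} {P : Measure Ω}
  {lam : Fin d → Ω → ℕ} {X : Finset (Fin d) → ℕ → Ω → 𝒳}

/-- The event that the change points are `m`. -/
def fiber (_h : N.IsRealization P lam X) (m : Fin d → ℕ) : Set Ω := {ω | ∀ j, lam j ω = m j}

theorem measurableSet_fiber (h : N.IsRealization P lam X) (m : Fin d → ℕ) :
    MeasurableSet (h.fiber m) := by
  have : h.fiber m = ⋂ j, lam j ⁻¹' {m j} := by ext; simp [fiber]
  rw [this]
  exact MeasurableSet.iInter fun j => h.measurable_lam j (measurableSet_singleton _)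

theorem measure_fiber (h : N.IsRealization P lam X) (m : Fin d → ℕ) :
    P (h.fiber m) = ENNReal.ofReal (N.priorWeight m) := by
  have := h.joint_law m 0 (fun _ _ => Set.univ) (fun _ _ => MeasurableSet.univ)
  simp only [priorWeight]
  rw [ENNReal.ofReal_prod_of_nonneg
    fun j _ => geomWeight_nonneg (N.ρ_pos j) (N.ρ_lt_one j) _]
  simpa [fiber] using this

/-- The conditional distribution given that the change points are `m`. -/
noncomputable def condLaw (h : N.IsRealization P lam X) (m : Fin d → ℕ) : Measure Ω :=
  P[|h.fiber m]

variable [IsProbabilityMeasure P]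

theorem isProbabilityMeasure_condLaw (h : N.IsRealization P lam X) {m : Fin d → ℕ}
    (hm : ∀ j, 1 ≤ m j) : IsProbabilityMeasure (h.condLaw m) := by
  refine cond_isProbabilityMeasure ?_
  rw [h.measure_fiber]
  simpa using N.priorWeight_pos hm

theorem restrict_fiber (h : N.IsRealization P lam X) (m : Fin d → ℕ) :
    P.restrict (h.fiber m) = ENNReal.ofReal (N.priorWeight m) • h.condLaw m := by
  rw [condLaw, ProbabilityTheory.cond, smul_smul, ← h.measure_fiber]
  by_cases h0 : P (h.fiber m) = 0
  · simp [h0]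
  · rw [ENNReal.mul_inv_cancel h0 (measure_ne_top _ _), one_smul]

theorem condLaw_rect (h : N.IsRealization P lam X) {m : Fin d → ℕ} (hm : ∀ j, 1 ≤ m j) (n : ℕ)
    {B : Finset (Fin d) → ℕ → Set 𝒳} (hB : ∀ e t, MeasurableSet (B e t)) :
    h.condLaw m {ω | ∀ e ∈ extEdges N.graph, ∀ t ∈ Finset.Icc 1 n, X e t ω ∈ B e t} =
      ∏ e ∈ extEdges N.graph, ∏ t ∈ Finset.Icc 1 n, N.obsLaw m e t (B e t) := by
  have hpos : P (h.fiber m) ≠ 0 := by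
    rw [h.measure_fiber]; simpa using N.priorWeight_pos hm
  rw [condLaw, ProbabilityTheory.cond_apply (h.measurableSet_fiber m)]
  have := h.joint_law m n B hB
  have h2 : h.fiber m ∩ {ω | ∀ e ∈ extEdges N.graph, ∀ t ∈ Finset.Icc 1 n, X e t ω ∈ B e t} =
    {ω | (∀ j, lam j ω = m j) ∧
        ∀ e ∈ extEdges N.graph, ∀ t ∈ Finset.Icc 1 n, X e t ω ∈ B e t} := rfl
  rw [h2, this, ← ENNReal.ofReal_prod_of_nonneg
    fun j _ => geomWeight_nonneg (N.ρ_pos j) (N.ρ_lt_one j) _, ← mul_assoc]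
  change (P (h.fiber m))⁻¹ * ENNReal.ofReal (N.priorWeight m) * _ = _
  rw [← h.measure_fiber, ENNReal.inv_mul_cancel hpos (measure_ne_top _ _), one_mul]
  refine Finset.prod_congr rfl fun e he => Finset.prod_congr rfl fun t ht => ?_
  rw [obsLaw, withDensity_apply _ (hB e t)]

theorem prod_attach_range {ι M : Type*} [CommMonoid M] (s : Finset ι) (n : ℕ)
    (F : ι → ℕ → M) :
    ∏ i ∈ s.attach ×ˢ Finset.range n, F i.1 (i.2 + 1) = ∏ e ∈ s, ∏ t ∈ Finset.Icc 1 n, F e t := by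
  rw [Finset.prod_product, ← Finset.prod_attach s]
  refine Finset.prod_congr rfl fun e _ => ?_
  rw [Finset.range_eq_Ico, Finset.prod_Ico_add' (fun t => F e t)]
  rfl

/-- A rectangle with a single nontrivial side isolates one factor of the product law; every other
factor is the total mass of a probability measure. -/
theorem map_obs (h : N.IsRealization P lam X) {m : Fin d → ℕ} (hm : ∀ j, 1 ≤ m j)
    {e : Finset (Fin d)} (he : e ∈ extEdges N.graph) {t : ℕ} (ht : 1 ≤ t) :
    (h.condLaw m).map (X e t) = N.obsLaw m e t := by
  classical
  have := fun e he m t => isProbabilityMeasure_obsLaw (N := N) (e := e) he m t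
  ext s hs
  rw [Measure.map_apply (h.measurable_obs e he t ht) hs]
  have key := h.condLaw_rect hm t (B := fun e' t' => if e' = e ∧ t' = t then s else Set.univ)
    (fun _ _ => by split_ifs <;> simp [hs])
  rw [Finset.prod_eq_single_of_mem e he, Finset.prod_eq_single_of_mem t
    (Finset.mem_Icc.2 ⟨ht, le_rfl⟩)] at key
  · simp only [and_self, if_true] at key
    rw [← key]
    congr 1
    ext ω
    constructor
    · intro hω e' he' t' ht'
      split_ifs with hc
      · rw [hc.1, hc.2]; exact hω
      · trivial
    · intro hω
      simpa using hω e he t (Finset.mem_Icc.2 ⟨ht, le_rfl⟩)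
  · intro t' _ htt
    simp [htt, (this e he m t').measure_univ]
  · intro e' he' hee
    refine Finset.prod_eq_one fun t' _ => ?_
    simp [hee, (this e' he' m t').measure_univ]

/-- The product form of `condLaw_rect` is independence once a finite family of sets is padded with
`univ` to a full rectangle. Observation times start at `1`, so the index `(e, s)` stands for time `s
+ 1`. -/
theorem iIndepFun_obs (h : N.IsRealization P lam X) {m : Fin d → ℕ} (hm : ∀ j, 1 ≤ m j) :
    iIndepFun (fun (i : ↥(extEdges N.graph) × ℕ) => X i.1 (i.2 + 1)) (h.condLaw m) := by
  classical
  have := fun e he m t => isProbabilityMeasure_obsLaw (N := N) (e := e) he m t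
  rw [iIndepFun_iff_measure_inter_preimage_eq_mul]
  intro S sets hsets
  obtain ⟨n, hn⟩ : ∃ n, ∀ i ∈ S, i.2 < n := by
    obtain ⟨n, hn⟩ := (S.image Prod.snd).exists_nat_subset_range
    exact ⟨n, fun i hi => Finset.mem_range.1 (hn (Finset.mem_image_of_mem _ hi))⟩
  let B : Finset (Fin d) → ℕ → Set 𝒳 := fun e t =>
    if hc : ∃ i ∈ S, (i.1 : Finset (Fin d)) = e ∧ i.2 + 1 = t then sets hc.choose else Set.univ
  have hB1 : ∀ i ∈ S, B i.1 (i.2 + 1) = sets i := by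
    intro i hi
    have hc : ∃ i' ∈ S, (i'.1 : Finset (Fin d)) = i.1 ∧ i'.2 + 1 = i.2 + 1 := ⟨i, hi, rfl, rfl⟩
    have : hc.choose = i :=
      Prod.ext (Subtype.ext hc.choose_spec.2.1) (by have := hc.choose_spec.2.2; omega)
    simp only [B, dif_pos hc, this]
  have hB2 : ∀ i ∉ S, B i.1 (i.2 + 1) = Set.univ := by
    intro i hi
    refine dif_neg ?_
    rintro ⟨i', hi', h1, h2⟩
    have : i' = i := Prod.ext (Subtype.ext h1) (by omega)
    exact hi (this ▸ hi')
  have hBm : ∀ e t, MeasurableSet (B e t) := by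
    intro e t
    simp only [B]
    split_ifs with hc
    · exact hsets _ hc.choose_spec.1
    · exact MeasurableSet.univ
  have key := h.condLaw_rect hm n hBm
  have hset : {ω | ∀ e ∈ extEdges N.graph, ∀ t ∈ Finset.Icc 1 n, X e t ω ∈ B e t} =
      ⋂ i ∈ S, (fun (i : ↥(extEdges N.graph) × ℕ) => X i.1 (i.2 + 1)) i ⁻¹' sets i := by
    ext ω
    simp only [Set.mem_ofPred_eq, Set.mem_iInter, Set.mem_preimage]
    constructor
    · intro H i hi
      rw [← hB1 i hi]
      exact H _ i.1.2 _ (Finset.mem_Icc.2 ⟨by omega, hn i hi⟩)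
    · intro H e he t ht
      obtain ⟨ht1, -⟩ := Finset.mem_Icc.1 ht
      obtain ⟨s, rfl⟩ : ∃ s, t = s + 1 := ⟨t - 1, by omega⟩
      by_cases hi : ((⟨e, he⟩, s) : ↥(extEdges N.graph) × ℕ) ∈ S
      · rw [hB1 _ hi]; exact H _ hi
      · rw [hB2 _ hi]; trivial
  rw [hset, ← prod_attach_range (extEdges N.graph) n fun e t => N.obsLaw m e t (B e t)] at key
  rw [key, ← Finset.prod_subset (s₁ := S)]
  · refine Finset.prod_congr rfl fun i hi => ?_
    rw [hB1 i hi, ← h.map_obs hm i.1.2 (by omega : 1 ≤ i.2 + 1),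
      Measure.map_apply (h.measurable_obs _ i.1.2 _ (by omega)) (hsets i hi)]
  · intro i hi
    simpa using hn i hi
  · intro i _ hi
    rw [hB2 i hi, (this _ i.1.2 m _).measure_univ]

theorem lintegral_prod_obs (h : N.IsRealization P lam X) {m : Fin d → ℕ} (hm : ∀ j, 1 ≤ m j)
    (n : ℕ) {u : Finset (Fin d) → ℕ → 𝒳 → ℝ≥0∞} (hu : ∀ e t, Measurable (u e t)) :
    ∫⁻ ω, ∏ e ∈ extEdges N.graph, ∏ t ∈ Finset.Icc 1 n, u e t (X e t ω) ∂(h.condLaw m) =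
      ∏ e ∈ extEdges N.graph, ∏ t ∈ Finset.Icc 1 n, ∫⁻ x, u e t x ∂(N.obsLaw m e t) := by
  have hind := (h.iIndepFun_obs hm).comp (fun i => u i.1 (i.2 + 1)) (fun i => hu _ _)
  have := lintegral_prod_eq_prod_lintegral_of_indepFun
    ((extEdges N.graph).attach ×ˢ Finset.range n) _ hind
    (fun i => (hu _ _).comp (h.measurable_obs _ i.1.2 _ (by omega)))
  simp only [Function.comp_apply] at this
  rw [← prod_attach_range (extEdges N.graph) n fun e t => ∫⁻ x, u e t x ∂(N.obsLaw m e t)]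
  rw [lintegral_congr fun ω =>
    (prod_attach_range (extEdges N.graph) n fun e t => u e t (X e t ω)).symm, this]
  refine Finset.prod_congr rfl fun i _ => ?_
  rw [← h.map_obs hm i.1.2 (by omega : 1 ≤ i.2 + 1),
    lintegral_map (hu _ _) (h.measurable_obs _ i.1.2 _ (by omega))]

end IsRealization

end ChangePointNetwork

/-! ### Log-likelihood ratios and change of measure between configurations. -/

namespace ChangePointNetwork

variable {d : ℕ} {𝒳 : Type*} [MeasurableSpace 𝒳] (N : ChangePointNetwork d 𝒳)

/-- The log-likelihood ratio `log (f e / g e)`, truncated to `[-M, M]`. -/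
noncomputable def llr (M : ℝ) (e : Finset (Fin d)) (x : 𝒳) : ℝ :=
  max (-M) (min M (Real.log (N.f e x / N.g e x)))

variable {N} {M : ℝ}

theorem abs_llr_le (hM0 : 0 ≤ M) (e : Finset (Fin d)) (x : 𝒳) : |N.llr M e x| ≤ M := by
  rw [abs_le, llr]
  exact ⟨le_max_left _ _, max_le (by linarith) (min_le_left _ _)⟩

theorem measurable_llr {e : Finset (Fin d)} (he : e ∈ extEdges N.graph) :
    Measurable (N.llr M e) := by
  have h1 := (N.f_density e he).measurable
  have h2 := (N.g_density e he).measurable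
  unfold llr
  fun_prop

theorem BoundedLLR.llr_eq (hM : N.BoundedLLR M) (hM0 : 0 ≤ M) {e : Finset (Fin d)}
    (he : e ∈ extEdges N.graph) :
    ∀ᵐ x ∂N.μ, N.llr M e x = Real.log (N.f e x / N.g e x) := by
  filter_upwards [hM e he] with x hx
  unfold llr
  rcases hx with ⟨h1, h2⟩ | ⟨-, -, h3⟩
  · simp [h1, h2, hM0]
  · rw [abs_le] at h3
    rw [min_eq_right h3.2, max_eq_right h3.1]

theorem BoundedLLR.f_eq (hM : N.BoundedLLR M) (hM0 : 0 ≤ M) {e : Finset (Fin d)}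
    (he : e ∈ extEdges N.graph) :
    ∀ᵐ x ∂N.μ, N.f e x = N.g e x * Real.exp (N.llr M e x) := by
  filter_upwards [hM e he, hM.llr_eq hM0 he] with x hx hl
  rw [hl]
  rcases hx with ⟨h1, h2⟩ | ⟨h1, h2, -⟩
  · simp [h1, h2]
  · rw [Real.exp_log (div_pos h1 h2)]
    field_simp

/-- Node or edge `e` is affected by time `t` under the configuration `m`. -/
abbrev Changed (m : Fin d → ℕ) (e : Finset (Fin d)) (t : ℕ) : Prop := ∃ j ∈ e, m j ≤ t

theorem coe_lt_minOver_iff_not_changed (m : Fin d → ℕ) (e : Finset (Fin d)) (t : ℕ) :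
    (t : ℕ∞) < minOver e m ↔ ¬ Changed m e t := by
  rw [coe_lt_minOver_iff]; push Not; rfl

/-- Common support makes `f e` and `g e` mutually absolutely continuous with density `exp (±llr)`.
The four cases are the possible states of `e` at time `t` under `m` and `m'`. -/
theorem BoundedLLR.withDensity_exp (hM : N.BoundedLLR M) (hM0 : 0 ≤ M) {e : Finset (Fin d)}
    (he : e ∈ extEdges N.graph) (m m' : Fin d → ℕ) (t : ℕ) :
    (N.obsLaw m e t).withDensity (fun x => ENNReal.ofReal (Real.exp
      ((if Changed m' e t then N.llr M e x else 0) - if Changed m e t then N.llr M e x else 0))) =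
      N.obsLaw m' e t := by
  have hl := measurable_llr (M := M) he
  have hf := (N.f_density e he).measurable
  have hg := (N.g_density e he).measurable
  by_cases h1 : Changed m e t <;> by_cases h2 : Changed m' e t <;>
    simp only [h1, h2, if_true, if_false, sub_self, Real.exp_zero, ENNReal.ofReal_one, zero_sub,
      sub_zero]
  · rw [N.obsLaw_of_not_lt (by rw [coe_lt_minOver_iff_not_changed]; simpa using h1),
      N.obsLaw_of_not_lt (by rw [coe_lt_minOver_iff_not_changed]; simpa using h2)]
    exact withDensity_one
  · rw [N.obsLaw_of_not_lt (by rw [coe_lt_minOver_iff_not_changed]; simpa using h1),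
      N.obsLaw_of_lt (by rwa [coe_lt_minOver_iff_not_changed]),
      ← withDensity_mul _ (by fun_prop) (by fun_prop)]
    refine withDensity_congr_ae ?_
    filter_upwards [hM.f_eq hM0 he] with x hx
    rw [Pi.mul_apply, ← ENNReal.ofReal_mul' (Real.exp_nonneg _), hx, mul_assoc, ← Real.exp_add]
    simp
  · rw [N.obsLaw_of_lt (by rwa [coe_lt_minOver_iff_not_changed]),
      N.obsLaw_of_not_lt (by rw [coe_lt_minOver_iff_not_changed]; simpa using h2),
      ← withDensity_mul _ (by fun_prop) (by fun_prop)]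
    refine withDensity_congr_ae ?_
    filter_upwards [hM.f_eq hM0 he] with x hx
    rw [Pi.mul_apply, ← ENNReal.ofReal_mul' (Real.exp_nonneg _), hx]
  · rw [N.obsLaw_of_lt (by rwa [coe_lt_minOver_iff_not_changed]),
      N.obsLaw_of_lt (by rwa [coe_lt_minOver_iff_not_changed])]
    exact withDensity_one

theorem BoundedLLR.integral_llr (hM : N.BoundedLLR M) (hM0 : 0 ≤ M) {e : Finset (Fin d)}
    (he : e ∈ extEdges N.graph) {m : Fin d → ℕ} {t : ℕ} (h : Changed m e t) :
    ∫ x, N.llr M e x ∂(N.obsLaw m e t) = N.info e := by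
  rw [N.obsLaw_of_not_lt (by rw [coe_lt_minOver_iff_not_changed]; simpa using h),
    integral_withDensity_eq_integral_toReal_smul
      (by have := (N.f_density e he).measurable; fun_prop) (by simp)]
  refine integral_congr_ae ?_
  filter_upwards [hM.llr_eq hM0 he] with x hx
  rw [hx, ENNReal.toReal_ofReal ((N.f_density e he).nonneg x), smul_eq_mul]

theorem integrable_llr (hM0 : 0 ≤ M) {e : Finset (Fin d)}
    (he : e ∈ extEdges N.graph) (m : Fin d → ℕ) (t : ℕ) :
    Integrable (N.llr M e) (N.obsLaw m e t) := by
  have := isProbabilityMeasure_obsLaw he m t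
  exact Integrable.of_bound (measurable_llr he).aestronglyMeasurable M
    (Eventually.of_forall fun x => abs_llr_le hM0 e x)

theorem BoundedLLR.info_nonneg (hM : N.BoundedLLR M) (hM0 : 0 ≤ M) {e : Finset (Fin d)}
    (he : e ∈ extEdges N.graph) (hne : e.Nonempty) : 0 ≤ N.info e := by
  have := isProbabilityMeasure_obsLaw (N := N) he
  obtain ⟨j, hj⟩ := hne
  -- The constant configurations `0` and `1` at time `0` serve only to produce the laws with
  -- densities `f e` and `g e`; their prior weights play no role.
  have h0 : Changed (fun _ => 0) e 0 := ⟨j, hj, le_rfl⟩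
  have h1 : ¬ Changed (fun _ => 1) e 0 := by simp [Changed]
  rw [← hM.integral_llr hM0 he h0]
  have hint : Integrable (fun x => Real.exp (-N.llr M e x)) (N.obsLaw (fun _ => 0) e 0) := by
    refine Integrable.of_bound (C := Real.exp M)
      (Real.measurable_exp.comp (measurable_llr he).neg).aestronglyMeasurable
      (Eventually.of_forall fun x => ?_)
    rw [Real.norm_eq_abs, Real.abs_exp, Real.exp_le_exp]
    exact (neg_le_abs _).trans (abs_llr_le hM0 e x)
  have hone : ∫ x, Real.exp (-N.llr M e x) ∂(N.obsLaw (fun _ => 0) e 0) = 1 := by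
    rw [integral_eq_lintegral_of_nonneg_ae (Eventually.of_forall fun x => Real.exp_nonneg _)
      hint.aestronglyMeasurable]
    have := congrArg (fun ν => ν Set.univ) (hM.withDensity_exp hM0 he (fun _ => 0) (fun _ => 1) 0)
    simp only [h0, h1, if_true, if_false, zero_sub, withDensity_apply _ MeasurableSet.univ,
      Measure.restrict_univ, measure_univ] at this
    rw [this]; rfl
  -- Gibbs' inequality in the form `1 - exp (-x) ≤ x`, where `exp (-llr)` has mean one under `f e`.
  have hle : ∫ x, (1 - Real.exp (-N.llr M e x)) ∂(N.obsLaw (fun _ => 0) e 0) ≤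
      ∫ x, N.llr M e x ∂(N.obsLaw (fun _ => 0) e 0) := by
    refine integral_mono ((integrable_const _).sub hint) (integrable_llr hM0 he _ _) fun x => ?_
    have := Real.add_one_le_exp (-N.llr M e x)
    simp only
    linarith
  rw [integral_sub (integrable_const _) hint, hone] at hle
  simpa using hle

theorem BoundedLLR.abs_info_le (hM : N.BoundedLLR M) (hM0 : 0 ≤ M) {e : Finset (Fin d)}
    (he : e ∈ extEdges N.graph) (hne : e.Nonempty) : |N.info e| ≤ M := by
  obtain ⟨j, hj⟩ := hne
  have := isProbabilityMeasure_obsLaw (N := N) he (fun _ => 0) 0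
  rw [← hM.integral_llr hM0 he (⟨j, hj, le_rfl⟩ : Changed (fun _ => 0) e 0)]
  simpa using norm_integral_le_of_norm_le_const (μ := N.obsLaw (fun _ => 0) e 0)
    (f := N.llr M e) (C := M) (Eventually.of_forall fun x => abs_llr_le hM0 e x)

theorem nonempty_of_mem_extEdges {G : SimpleGraph (Fin d)} {e : Finset (Fin d)}
    (he : e ∈ extEdges G) : e.Nonempty := by
  classical
  simp only [extEdges, Finset.mem_filter] at he
  rcases he.2 with ⟨j, rfl⟩ | ⟨i, j, -, rfl⟩ <;> simp

namespace IsRealization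

variable {Ω : Type*} [mΩ : MeasurableSpace Ω] {P : Measure Ω}
  {lam : Fin d → Ω → ℕ} {X : Finset (Fin d) → ℕ → Ω → 𝒳}

/-- The cylinder sets of the observations up to time `n`. -/
def obsRects (_h : N.IsRealization P lam X) (n : ℕ) : Set (Set Ω) :=
  {A | ∃ B : Finset (Fin d) → ℕ → Set 𝒳, (∀ e t, MeasurableSet (B e t)) ∧
    A = {ω | ∀ e ∈ extEdges N.graph, ∀ t ∈ Finset.Icc 1 n, X e t ω ∈ B e t}}

theorem measurable_obs_obsFiltration (h : N.IsRealization P lam X) {e : Finset (Fin d)}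
    (he : e ∈ extEdges N.graph) {t n : ℕ} (ht : t ∈ Finset.Icc 1 n) :
    Measurable[h.obsFiltration n] (X e t) := by
  refine Measurable.of_comap_le ?_
  exact le_iSup₂_of_le (f := fun e (_ : e ∈ extEdges N.graph) => ⨆ t ∈ Finset.Icc 1 n,
    MeasurableSpace.comap (X e t) inferInstance) e he
    (le_iSup₂_of_le (f := fun t (_ : t ∈ Finset.Icc 1 n) =>
      MeasurableSpace.comap (X e t) inferInstance) t ht le_rfl)

theorem isPiSystem_obsRects (h : N.IsRealization P lam X) (n : ℕ) :
    IsPiSystem (h.obsRects n) := by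
  rintro _ ⟨B, hB, rfl⟩ _ ⟨B', hB', rfl⟩ -
  refine ⟨fun e t => B e t ∩ B' e t, fun e t => (hB e t).inter (hB' e t), ?_⟩
  ext ω
  constructor
  · rintro ⟨h1, h2⟩ e he t ht
    exact ⟨h1 e he t ht, h2 e he t ht⟩
  · intro H
    exact ⟨fun e he t ht => (H e he t ht).1, fun e he t ht => (H e he t ht).2⟩

theorem obsFiltration_eq_generateFrom (h : N.IsRealization P lam X) (n : ℕ) :
    (h.obsFiltration n : MeasurableSpace Ω) = MeasurableSpace.generateFrom (h.obsRects n) := by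
  classical
  apply le_antisymm
  · refine iSup₂_le fun e he => iSup₂_le fun t ht => ?_
    rintro _ ⟨s, hs, rfl⟩
    refine MeasurableSpace.measurableSet_generateFrom
      ⟨fun e' t' => if e' = e ∧ t' = t then s else Set.univ, ?_, ?_⟩
    · intro e' t'; dsimp only; split_ifs <;> simp [hs]
    · ext ω
      constructor
      · intro hω e' he' t' ht'
        dsimp only
        split_ifs with hc
        · rw [hc.1, hc.2]; exact hω
        · trivial
      · intro hω
        simpa using hω e he t ht
  · refine MeasurableSpace.generateFrom_le ?_
    rintro _ ⟨B, hB, rfl⟩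
    have : {ω | ∀ e ∈ extEdges N.graph, ∀ t ∈ Finset.Icc 1 n, X e t ω ∈ B e t} =
        ⋂ e ∈ extEdges N.graph, ⋂ t ∈ Finset.Icc 1 n, X e t ⁻¹' B e t := by
      ext; simp only [Set.mem_ofPred_eq, Set.mem_iInter, Set.mem_preimage]
    rw [this]
    exact Finset.measurableSet_biInter _ fun e he => Finset.measurableSet_biInter _ fun t ht =>
      h.measurable_obs_obsFiltration he ht (hB e t)

theorem measurable_prod_obs (h : N.IsRealization P lam X)
    (n : ℕ) {u : Finset (Fin d) → ℕ → 𝒳 → ℝ≥0∞}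
    (hu : ∀ e ∈ extEdges N.graph, ∀ t, Measurable (u e t)) :
    Measurable[h.obsFiltration n]
      (fun ω => ∏ e ∈ extEdges N.graph, ∏ t ∈ Finset.Icc 1 n, u e t (X e t ω)) := by
  refine Finset.measurable_prod _ fun e he => Finset.measurable_prod _ fun t ht => ?_
  exact (hu e he t).comp (h.measurable_obs_obsFiltration he ht)

/-- The log-likelihood of the configuration `m`, relative to the no-change regime, of the
observations up to time `n`. -/
noncomputable def logLik (_h : N.IsRealization P lam X) (M : ℝ) (m : Fin d → ℕ) (n : ℕ) (ω : Ω) :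
    ℝ :=
  ∑ e ∈ extEdges N.graph, ∑ t ∈ Finset.Icc 1 n,
    if Changed m e t then N.llr M e (X e t ω) else 0

theorem measurable_logLik (h : N.IsRealization P lam X) (m : Fin d → ℕ) (n : ℕ) :
    Measurable[h.obsFiltration n] (h.logLik M m n) := by
  refine Finset.measurable_sum _ fun e he => Finset.measurable_sum _ fun t ht => ?_
  by_cases hc : Changed m e t <;> simp only [hc, if_true, if_false]
  · exact (measurable_llr he).comp (h.measurable_obs_obsFiltration he ht)
  · exact measurable_const

variable [IsProbabilityMeasure P]

/-- Change of measure between conditional distributions on the observations up to time `n`, by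
a product density that may carry factors of mean one after time `n`. -/
theorem trim_withDensity (h : N.IsRealization P lam X) {m m' : Fin d → ℕ} (hm : ∀ j, 1 ≤ m j)
    (hm' : ∀ j, 1 ≤ m' j) {n n' : ℕ} (hn : n ≤ n') {u : Finset (Fin d) → ℕ → 𝒳 → ℝ≥0∞}
    (hu : ∀ e t, Measurable (u e t))
    (hu1 : ∀ e ∈ extEdges N.graph, ∀ t ∈ Finset.Icc 1 n,
      (N.obsLaw m e t).withDensity (u e t) = N.obsLaw m' e t)
    (hu2 : ∀ e ∈ extEdges N.graph, ∀ t ∈ Finset.Ioc n n', ∫⁻ x, u e t x ∂(N.obsLaw m e t) = 1) :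
    ((h.condLaw m).withDensity fun ω =>
      ∏ e ∈ extEdges N.graph, ∏ t ∈ Finset.Icc 1 n', u e t (X e t ω)).trim
        (h.obsFiltration.le n) = (h.condLaw m').trim (h.obsFiltration.le n) := by
  classical
  have hprob := fun e he m t => isProbabilityMeasure_obsLaw (N := N) (e := e) he m t
  have := h.isProbabilityMeasure_condLaw hm
  have := h.isProbabilityMeasure_condLaw hm'
  set Z : Ω → ℝ≥0∞ := fun ω => ∏ e ∈ extEdges N.graph, ∏ t ∈ Finset.Icc 1 n', u e t (X e t ω)
    with hZ
  have key : ∀ A ∈ h.obsRects n, (h.condLaw m).withDensity Z A = h.condLaw m' A := by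
    intro A hA
    have hAm : MeasurableSet A := by
      refine h.obsFiltration.le n A ?_
      rw [h.obsFiltration_eq_generateFrom]
      exact MeasurableSpace.measurableSet_generateFrom hA
    obtain ⟨B, hB, rfl⟩ := hA
    rw [h.condLaw_rect hm' n hB, withDensity_apply _ hAm, ← lintegral_indicator hAm]
    -- The indicator of the rectangle is distributed over the factors with `t ≤ n`, so that the
    -- integrand is again a product over single observations.
    set w : Finset (Fin d) → ℕ → 𝒳 → ℝ≥0∞ := fun e t x =>
      (if t ∈ Finset.Icc 1 n then (B e t).indicator 1 x else 1) * u e t x with hw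
    have hwm : ∀ e t, Measurable (w e t) := by
      intro e t
      refine Measurable.mul ?_ (hu e t)
      split_ifs
      · exact measurable_one.indicator (hB e t)
      · exact measurable_const
    have hsub : Finset.Icc 1 n ⊆ Finset.Icc 1 n' := Finset.Icc_subset_Icc_right hn
    have h1 : ∀ ω, ({ω | ∀ e ∈ extEdges N.graph, ∀ t ∈ Finset.Icc 1 n, X e t ω ∈ B e t} :
        Set Ω).indicator Z ω = ∏ e ∈ extEdges N.graph, ∏ t ∈ Finset.Icc 1 n', w e t (X e t ω) := by
      intro ω
      by_cases hω : ∀ e ∈ extEdges N.graph, ∀ t ∈ Finset.Icc 1 n, X e t ω ∈ B e t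
      · rw [Set.indicator_of_mem (by exact hω)]
        refine Finset.prod_congr rfl fun e he => Finset.prod_congr rfl fun t ht => ?_
        by_cases ht' : t ∈ Finset.Icc 1 n
        · simp only [hw, if_pos ht', Set.indicator_of_mem (hω e he t ht'), Pi.one_apply, one_mul]
        · simp only [hw, if_neg ht', one_mul]
      · rw [Set.indicator_of_notMem (by exact hω)]
        push Not at hω
        obtain ⟨e, he, t, ht, hx⟩ := hω
        refine (Finset.prod_eq_zero he (Finset.prod_eq_zero (hsub ht) ?_)).symm
        simp only [hw, if_pos ht, Set.indicator_of_notMem hx, zero_mul]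
    rw [lintegral_congr h1, h.lintegral_prod_obs hm n' hwm]
    refine Finset.prod_congr rfl fun e he => ?_
    rw [← Finset.prod_subset hsub]
    · refine Finset.prod_congr rfl fun t ht => ?_
      rw [← hu1 e he t ht, withDensity_apply _ (hB e t), ← lintegral_indicator (hB e t)]
      refine lintegral_congr fun x => ?_
      by_cases hx : x ∈ B e t <;> simp only [hw, if_pos ht, Set.indicator_of_mem,
        Set.indicator_of_notMem, hx, Pi.one_apply, one_mul, zero_mul, not_false_eq_true]
    · intro t ht ht'
      simp only [hw, if_neg ht', one_mul]
      refine hu2 e he t ?_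
      simp only [Finset.mem_Icc, Finset.mem_Ioc] at *
      omega
  have huniv : (Set.univ : Set Ω) ∈ h.obsRects n :=
    ⟨fun _ _ => Set.univ, fun _ _ => MeasurableSet.univ, by ext; simp⟩
  have hfin : IsFiniteMeasure ((h.condLaw m).withDensity Z) := by
    constructor
    rw [key _ huniv]
    exact measure_lt_top _ _
  have hmeas : ∀ A ∈ h.obsRects n, MeasurableSet[h.obsFiltration n] A := by
    intro A hA
    rw [h.obsFiltration_eq_generateFrom]
    exact MeasurableSpace.measurableSet_generateFrom hA
  refine @ext_of_generate_finite Ω (h.obsFiltration n) _ _ (h.obsRects n)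
    (h.obsFiltration_eq_generateFrom n) (h.isPiSystem_obsRects n) _ (fun A hA => ?_) ?_
  · rw [trim_measurableSet_eq _ (hmeas A hA), trim_measurableSet_eq _ (hmeas A hA), key A hA]
  · rw [trim_measurableSet_eq _ (hmeas _ huniv), trim_measurableSet_eq _ (hmeas _ huniv),
      key _ huniv]

/-- The difference of the two log-likelihoods is the log density of one conditional law against the
other on `obsFiltration n`; the no-change reference cancels. -/
theorem lintegral_exp_logLik_mul (hM : N.BoundedLLR M) (hM0 : 0 ≤ M) (h : N.IsRealization P lam X)
    {m m' : Fin d → ℕ} (hm : ∀ j, 1 ≤ m j) (hm' : ∀ j, 1 ≤ m' j) {n : ℕ}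
    {F : Ω → ℝ≥0∞} (hF : Measurable[h.obsFiltration n] F) :
    ∫⁻ ω, ENNReal.ofReal (Real.exp (h.logLik M m' n ω - h.logLik M m n ω)) * F ω
      ∂(h.condLaw m) = ∫⁻ ω, F ω ∂(h.condLaw m') := by
  classical
  -- The value `1` off the extended edges supplies measurability for all indices, since `f e` and `g
  -- e` are controlled only on extended edges.
  set u : Finset (Fin d) → ℕ → 𝒳 → ℝ≥0∞ := fun e t x =>
    if e ∈ extEdges N.graph then ENNReal.ofReal (Real.exp
      ((if Changed m' e t then N.llr M e x else 0) - if Changed m e t then N.llr M e x else 0))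
    else 1 with hu
  have hum : ∀ e t, Measurable (u e t) := by
    intro e t
    by_cases he : e ∈ extEdges N.graph
    · have := measurable_llr (M := M) he
      simp only [hu, if_pos he]
      split_ifs <;> fun_prop
    · simp only [hu, if_neg he]; exact measurable_const
  have key := h.trim_withDensity hm hm' (le_refl n) hum
    (fun e he t _ => by simp only [hu, if_pos he]; exact hM.withDensity_exp hM0 he m m' t)
    (fun e he t ht => by simp at ht)
  have hprod : ∀ ω, ENNReal.ofReal (Real.exp (h.logLik M m' n ω - h.logLik M m n ω)) =
      ∏ e ∈ extEdges N.graph, ∏ t ∈ Finset.Icc 1 n, u e t (X e t ω) := by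
    intro ω
    rw [logLik, logLik, ← Finset.sum_sub_distrib, Real.exp_sum,
      ENNReal.ofReal_prod_of_nonneg fun _ _ => Real.exp_nonneg _]
    refine Finset.prod_congr rfl fun e he => ?_
    rw [← Finset.sum_sub_distrib, Real.exp_sum,
      ENNReal.ofReal_prod_of_nonneg fun _ _ => Real.exp_nonneg _]
    refine Finset.prod_congr rfl fun t _ => ?_
    simp only [hu, if_pos he]
  simp_rw [hprod]
  rw [← lintegral_trim (h.obsFiltration.le n) hF (μ := h.condLaw m'), ← key, lintegral_trim _ hF,
    lintegral_withDensity_eq_lintegral_mul _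
      ((h.measurable_prod_obs n fun e _ t => hum e t).mono (h.obsFiltration.le n) le_rfl)
      (hF.mono (h.obsFiltration.le n) le_rfl)]
  rfl

end IsRealization

end ChangePointNetwork

/-! ### Memorylessness of the prior, mixture likelihoods and Bayes' formula. -/

namespace ChangePointNetwork

variable {d : ℕ} {𝒳 : Type*} [MeasurableSpace 𝒳] {N : ChangePointNetwork d 𝒳} {M : ℝ}

/-- Delay the change points in `S` by `n`. -/
def shift (S : Finset (Fin d)) (n : ℕ) (m : Fin d → ℕ) : Fin d → ℕ :=
  fun j => if j ∈ S then m j + n else m j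

theorem shift_injective (S : Finset (Fin d)) (n : ℕ) : Function.Injective (shift S n) := by
  intro m m' h
  funext j
  have := congrFun h j
  by_cases hj : j ∈ S <;> simp only [shift, hj, if_true, if_false] at this <;> omega

theorem one_le_shift {m : Fin d → ℕ} (hm : ∀ j, 1 ≤ m j) (S : Finset (Fin d)) (n : ℕ) (j : Fin d) :
    1 ≤ shift S n m j := by
  have := hm j
  unfold shift
  split_ifs <;> omega

/-- Since `m j ≥ 1`, a change point delayed by `n` lies strictly beyond `n ≥ t`, so up to time `n`
only the nodes of `e` outside `S` can trigger a change. -/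
theorem changed_shift_iff {m : Fin d → ℕ} (hm : ∀ j, 1 ≤ m j) (S e : Finset (Fin d)) {t n : ℕ}
    (ht : t ≤ n) : Changed (shift S n m) e t ↔ Changed m (e \ S) t := by
  constructor
  · rintro ⟨j, hj, h⟩
    have := hm j
    by_cases hS : j ∈ S
    · simp only [shift, hS, if_true] at h; omega
    · simp only [shift, hS, if_false] at h
      exact ⟨j, Finset.mem_sdiff.2 ⟨hj, hS⟩, h⟩
  · rintro ⟨j, hj, h⟩
    rw [Finset.mem_sdiff] at hj
    exact ⟨j, hj.1, by simpa [shift, hj.2] using h⟩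

variable (N) in
theorem prod_one_sub_pos (S : Finset (Fin d)) : 0 < ∏ j ∈ S, (1 - N.ρ j) :=
  Finset.prod_pos fun j _ => by linarith [N.ρ_lt_one j]

variable (N) in
theorem exp_neg_priorRate_mul (S : Finset (Fin d)) (n : ℕ) :
    Real.exp (-(N.priorRate S * n)) = (∏ j ∈ S, (1 - N.ρ j)) ^ n := by
  rw [priorRate, neg_mul, neg_neg, mul_comm, Real.exp_nat_mul,
    Real.exp_log (N.prod_one_sub_pos S)]

theorem priorRate_pos {S : Finset (Fin d)} (hS : S.Nonempty) : 0 < N.priorRate S := by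
  rw [priorRate, neg_pos]
  refine Real.log_neg (N.prod_one_sub_pos S) ?_
  calc ∏ j ∈ S, (1 - N.ρ j) < ∏ j ∈ S, (1 : ℝ) :=
        Finset.prod_lt_prod_of_nonempty (fun j _ => by linarith [N.ρ_lt_one j])
          (fun j _ => by linarith [N.ρ_pos j]) hS
    _ = 1 := by simp

theorem geomWeight_add {ρ : ℝ} {k : ℕ} (hk : 1 ≤ k) (n : ℕ) :
    geomWeight ρ (k + n) = (1 - ρ) ^ n * geomWeight ρ k := by
  rw [geomWeight, geomWeight, if_neg (by omega), if_neg (by omega), ← mul_assoc, ← pow_add]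
  congr 2
  omega

theorem priorWeight_shift {m : Fin d → ℕ} (hm : ∀ j, 1 ≤ m j) (S : Finset (Fin d)) (n : ℕ) :
    N.priorWeight (shift S n m) = Real.exp (-(N.priorRate S * n)) * N.priorWeight m := by
  classical
  rw [N.exp_neg_priorRate_mul, priorWeight, priorWeight, ← Finset.prod_pow,
    ← Finset.prod_subset (Finset.subset_univ S) (f := fun j => if j ∈ S then (1 - N.ρ j) ^ n else 1)
      (fun j _ hj => if_neg hj) |>.symm.trans
      (Finset.prod_congr rfl fun j hj => if_pos hj), ← Finset.prod_mul_distrib]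
  refine Finset.prod_congr rfl fun j _ => ?_
  by_cases hj : j ∈ S
  · simp only [shift, hj, if_true, geomWeight_add (hm j)]
  · simp only [shift, hj, if_false, one_mul]

/-- Memorylessness in sum form: `shift S n` reindexes the configurations whose change points in `S`
all exceed `n`, and each weight picks up the factor `exp (-q n)`. -/
theorem tsum_priorWeight_shift (S : Finset (Fin d)) (n : ℕ) (G : (Fin d → ℕ) → ℝ≥0∞) :
    ∑' m, (if ∀ j ∈ S, n < m j then ENNReal.ofReal (N.priorWeight m) * G m else 0) =
      ENNReal.ofReal (Real.exp (-(N.priorRate S * n))) *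
        ∑' m, ENNReal.ofReal (N.priorWeight m) * G (shift S n m) := by
  rw [← ENNReal.tsum_mul_left, ← (shift_injective S n).tsum_eq]
  · refine tsum_congr fun m => ?_
    by_cases hm : ∀ j, 1 ≤ m j
    · rw [if_pos, priorWeight_shift hm, ENNReal.ofReal_mul (Real.exp_nonneg _), mul_assoc]
      intro j hj
      have := hm j
      simp only [shift, hj, if_true]
      omega
    -- With a zero coordinate both sides vanish: a zero in `S` violates the strict inequality after
    -- the shift, and a zero outside `S` survives the shift and kills the weight.
    · have h0 : N.priorWeight m = 0 := by
        by_contra h; exact hm (N.one_le_of_priorWeight_ne_zero h)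
      rw [h0]
      simp only [ENNReal.ofReal_zero, zero_mul, mul_zero, ite_eq_right_iff]
      intro hS
      push Not at hm
      obtain ⟨j, hj⟩ := hm
      by_cases hjS : j ∈ S
      · have := hS j hjS
        simp only [shift, hjS, if_true] at this
        omega
      · have : N.priorWeight (shift S n m) = 0 := by
          by_contra h
          have := N.one_le_of_priorWeight_ne_zero h j
          simp only [shift, hjS, if_false] at this
          omega
        rw [this]; simp
  · intro m hm
    rw [Function.mem_support] at hm
    have hS : ∀ j ∈ S, n < m j := by
      by_contra h; exact hm (if_neg h)
    refine ⟨fun j => if j ∈ S then m j - n else m j, ?_⟩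
    funext j
    by_cases hj : j ∈ S
    · have := hS j hj
      simp only [shift, hj, if_true]
      omega
    · simp only [shift, hj, if_false]

namespace IsRealization

variable {Ω : Type*} [mΩ : MeasurableSpace Ω] {P : Measure Ω}
  {lam : Fin d → Ω → ℕ} {X : Finset (Fin d) → ℕ → Ω → 𝒳}

theorem measurable_lamVec (h : N.IsRealization P lam X) : Measurable fun ω j => lam j ω :=
  measurable_pi_lambda _ h.measurable_lam

theorem coe_lt_phi_iff (h : N.IsRealization P lam X) (S : Finset (Fin d)) (n : ℕ) (ω : Ω) :
    (n : ℕ∞) < h.phi S ω ↔ ∀ j ∈ S, n < lam j ω := coe_lt_minOver_iff _ _ _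

theorem iUnion_fiber (h : N.IsRealization P lam X) : ⋃ m, h.fiber m = Set.univ := by
  ext ω
  simp only [Set.mem_iUnion, Set.mem_univ, iff_true]
  exact ⟨fun j => lam j ω, fun j => rfl⟩

theorem pairwise_disjoint_fiber (h : N.IsRealization P lam X) :
    Pairwise (Function.onFun Disjoint h.fiber) := by
  intro m m' hne
  refine Set.disjoint_left.2 fun ω hω hω' => hne ?_
  funext j
  rw [← hω j, ← hω' j]

theorem ae_one_le_lam (h : N.IsRealization P lam X) : ∀ᵐ ω ∂P, ∀ j, 1 ≤ lam j ω := by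
  rw [ae_iff]
  refine measure_mono_null (t := ⋃ m ∈ {m : Fin d → ℕ | ¬ ∀ j, 1 ≤ m j}, h.fiber m) ?_ ?_
  · intro ω hω
    exact Set.mem_biUnion (x := fun j => lam j ω) hω fun j => rfl
  · refine (measure_biUnion_null_iff (Set.to_countable _)).2 fun m hm => ?_
    rw [h.measure_fiber, ENNReal.ofReal_eq_zero]
    by_contra hc
    exact hm (N.one_le_of_priorWeight_ne_zero (by linarith [not_le.1 hc] : N.priorWeight m ≠ 0))

/-- Marginal likelihood, relative to the no-change regime, of the configurations of change points
that satisfy `p`. -/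
noncomputable def mixLik (h : N.IsRealization P lam X) (M : ℝ) (p : (Fin d → ℕ) → Prop) (n : ℕ)
    (ω : Ω) : ℝ≥0∞ :=
  open Classical in
  ∑' m, if p m then
    ENNReal.ofReal (N.priorWeight m) * ENNReal.ofReal (Real.exp (h.logLik M m n ω)) else 0

theorem measurable_mixLik (h : N.IsRealization P lam X) (p : (Fin d → ℕ) → Prop) (n : ℕ) :
    Measurable[h.obsFiltration n] (h.mixLik M p n) := by
  unfold mixLik
  refine Measurable.ennreal_tsum fun m => ?_
  by_cases hp : p m <;> simp only [hp, if_true, if_false]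
  · exact Measurable.const_mul (ENNReal.measurable_ofReal.comp
      (Real.measurable_exp.comp (h.measurable_logLik m n))) _
  · exact measurable_const

theorem mixLik_add_not (h : N.IsRealization P lam X) (p : (Fin d → ℕ) → Prop) (n : ℕ) (ω : Ω) :
    h.mixLik M p n ω + h.mixLik M (fun m => ¬ p m) n ω = h.mixLik M (fun _ => True) n ω := by
  rw [mixLik, mixLik, mixLik, ← ENNReal.tsum_add]
  refine tsum_congr fun m => ?_
  by_cases hp : p m <;> simp [hp]

theorem abs_logLik_le (hM0 : 0 ≤ M) (h : N.IsRealization P lam X) (m : Fin d → ℕ) (n : ℕ) (ω : Ω) :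
    |h.logLik M m n ω| ≤ (extEdges N.graph).card * (n * M) := by
  unfold logLik
  refine (Finset.abs_sum_le_sum_abs _ _).trans ?_
  refine (Finset.sum_le_card_nsmul _ _ (n * M) fun e he => ?_).trans (by rw [nsmul_eq_mul])
  refine (Finset.abs_sum_le_sum_abs _ _).trans ?_
  refine (Finset.sum_le_card_nsmul _ _ M fun t ht => ?_).trans (by simp)
  split_ifs
  · exact abs_llr_le hM0 _ _
  · simpa using hM0

theorem le_mixLik (h : N.IsRealization P lam X) {p : (Fin d → ℕ) → Prop} {m : Fin d → ℕ}
    (hp : p m) (n : ℕ) (ω : Ω) :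
    ENNReal.ofReal (N.priorWeight m) * ENNReal.ofReal (Real.exp (h.logLik M m n ω)) ≤
      h.mixLik M p n ω := by
  classical
  unfold mixLik
  convert ENNReal.le_tsum (f := fun m => if p m then
    ENNReal.ofReal (N.priorWeight m) * ENNReal.ofReal (Real.exp (h.logLik M m n ω)) else 0) m
    using 1
  simp [hp]

theorem mixLik_true_ne_zero (h : N.IsRealization P lam X) (n : ℕ) (ω : Ω) :
    h.mixLik M (fun _ => True) n ω ≠ 0 := by
  refine (lt_of_lt_of_le ?_ (h.le_mixLik (m := fun _ => 1) trivial n ω)).ne'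
  refine ENNReal.mul_pos ?_ ?_
  · simpa using N.priorWeight_pos (m := fun _ => 1) fun _ => le_rfl
  · simpa using Real.exp_pos _

variable [IsProbabilityMeasure P]

/-- `lam` is constant on each of countably many measurable fibers, so no measurability of `F` is
needed. -/
theorem lintegral_eq_tsum (h : N.IsRealization P lam X) (F : (Fin d → ℕ) → Ω → ℝ≥0∞) :
    ∫⁻ ω, F (fun j => lam j ω) ω ∂P =
      ∑' m, ENNReal.ofReal (N.priorWeight m) * ∫⁻ ω, F m ω ∂(h.condLaw m) := by
  rw [← setLIntegral_univ, ← h.iUnion_fiber,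
    lintegral_iUnion h.measurableSet_fiber h.pairwise_disjoint_fiber]
  refine tsum_congr fun m => ?_
  rw [← smul_eq_mul, ← lintegral_smul_measure, ← h.restrict_fiber]
  refine setLIntegral_congr_fun (h.measurableSet_fiber m) fun ω hω => ?_
  have : (fun j => lam j ω) = m := funext hω
  simp only [this]

theorem tsum_priorWeight (h : N.IsRealization P lam X) :
    ∑' m, ENNReal.ofReal (N.priorWeight m) = 1 := by
  have := h.lintegral_eq_tsum fun _ _ => 1
  rw [lintegral_one, measure_univ] at this
  rw [this]
  refine tsum_congr fun m => ?_
  by_cases hm : N.priorWeight m = 0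
  · simp [hm]
  · have := h.isProbabilityMeasure_condLaw (N.one_le_of_priorWeight_ne_zero hm)
    simp

/-- The memoryless identity with `S = {j}` and the constant function `1`, instead of a summed
geometric tail. -/
theorem measure_lt_lam (h : N.IsRealization P lam X) (j : Fin d) (n : ℕ) :
    P {ω | n < lam j ω} = ENNReal.ofReal ((1 - N.ρ j) ^ n) := by
  have h1 := h.lintegral_eq_tsum fun m _ => if n < m j then 1 else 0
  have h2 := tsum_priorWeight_shift (N := N) {j} n fun _ => 1
  simp only [Finset.mem_singleton, forall_eq, mul_one, h.tsum_priorWeight,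
    N.exp_neg_priorRate_mul, Finset.prod_singleton] at h2
  rw [← h2]
  have hm : MeasurableSet {ω | n < lam j ω} := h.measurable_lam j measurableSet_Ioi
  have h3 : ∫⁻ ω, (if n < lam j ω then 1 else 0) ∂P = P {ω | n < lam j ω} := by
    rw [← lintegral_indicator_one hm]
    refine lintegral_congr fun ω => ?_
    simp only [Set.indicator_apply, Set.mem_ofPred_eq, Pi.one_apply]
  rw [← h3, h1]
  refine tsum_congr fun m => ?_
  by_cases hm : N.priorWeight m = 0
  · simp [hm]
  · have := h.isProbabilityMeasure_condLaw (N.one_le_of_priorWeight_ne_zero hm)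
    split_ifs <;> simp

theorem lintegral_lam_lt_top (h : N.IsRealization P lam X) (j : Fin d) :
    ∫⁻ ω, (lam j ω : ℝ≥0∞) ∂P < ∞ := by
  have h1 : ∀ ω, (lam j ω : ℝ≥0∞) = ∑' n : ℕ, if n < lam j ω then 1 else 0 := by
    intro ω
    rw [tsum_eq_sum (s := Finset.range (lam j ω)) (fun n hn => if_neg (by simpa using hn)),
      Finset.sum_congr rfl fun n hn => if_pos (Finset.mem_range.1 hn)]
    simp
  have hm : ∀ n, MeasurableSet {ω | n < lam j ω} := fun n => h.measurable_lam j measurableSet_Ioi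
  simp_rw [h1]
  rw [lintegral_tsum fun n => (Measurable.ite (hm n) measurable_const measurable_const).aemeasurable]
  have h3 : ∀ n, ∫⁻ ω, (if n < lam j ω then 1 else 0) ∂P = ENNReal.ofReal (1 - N.ρ j) ^ n := by
    intro n
    rw [← ENNReal.ofReal_pow (by linarith [N.ρ_lt_one j]), ← h.measure_lt_lam j n,
      ← lintegral_indicator_one (hm n)]
    refine lintegral_congr fun ω => ?_
    simp only [Set.indicator_apply, Set.mem_ofPred_eq, Pi.one_apply]
  simp_rw [h3]
  rw [ENNReal.tsum_geometric]
  refine ENNReal.inv_lt_top.2 (tsub_pos_of_lt ?_)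
  rw [ENNReal.ofReal_lt_one]
  linarith [N.ρ_pos j]

theorem integrable_lam (h : N.IsRealization P lam X) (j : Fin d) :
    Integrable (fun ω => (lam j ω : ℝ)) P := by
  refine ⟨(measurable_from_top.comp (h.measurable_lam j)).aestronglyMeasurable, ?_⟩
  have := h.lintegral_lam_lt_top j
  simpa [HasFiniteIntegral, Real.enorm_natCast] using this

theorem mixLik_ne_top (hM0 : 0 ≤ M) (h : N.IsRealization P lam X) (p : (Fin d → ℕ) → Prop) (n : ℕ)
    (ω : Ω) : h.mixLik M p n ω ≠ ∞ := by
  refine ne_top_of_le_ne_top (b := ∑' m, ENNReal.ofReal (N.priorWeight m) *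
    ENNReal.ofReal (Real.exp ((extEdges N.graph).card * (n * M)))) ?_ ?_
  · rw [ENNReal.tsum_mul_right, h.tsum_priorWeight]; simp
  · refine ENNReal.tsum_le_tsum fun m => ?_
    split_ifs
    · gcongr
      exact (le_abs_self _).trans (h.abs_logLik_le hM0 m n ω)
    · simp

/-- Brings all conditional laws to a single reference measure. The no-change law is not one of the
conditional laws, so the configuration `1` is the reference and its likelihood is divided out. -/
theorem lintegral_ite_eq_mixLik (hM : N.BoundedLLR M) (hM0 : 0 ≤ M)
    (h : N.IsRealization P lam X) (p : (Fin d → ℕ) → Prop) [DecidablePred p] {n : ℕ}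
    {F : Ω → ℝ≥0∞} (hF : Measurable[h.obsFiltration n] F) :
    ∫⁻ ω, (if p (fun j => lam j ω) then F ω else 0) ∂P =
      ∫⁻ ω, h.mixLik M p n ω *
        (ENNReal.ofReal (Real.exp (-h.logLik M (fun _ => 1) n ω)) * F ω)
        ∂(h.condLaw fun _ => 1) := by
  have hl := fun m => (h.measurable_logLik (M := M) m n).mono (h.obsFiltration.le n) le_rfl
  have hF' := hF.mono (h.obsFiltration.le n) le_rfl
  rw [h.lintegral_eq_tsum fun m ω => if p m then F ω else 0]
  unfold mixLik
  simp_rw [← ENNReal.tsum_mul_right]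
  rw [lintegral_tsum]
  · refine tsum_congr fun m => ?_
    by_cases hp : p m
    · simp only [hp, if_true]
      by_cases hm : N.priorWeight m = 0
      · simp [hm]
      rw [← lintegral_exp_logLik_mul hM hM0 h (fun _ => le_rfl)
        (N.one_le_of_priorWeight_ne_zero hm) hF, ← lintegral_const_mul]
      · refine lintegral_congr fun ω => ?_
        rw [sub_eq_add_neg, Real.exp_add, ENNReal.ofReal_mul (Real.exp_nonneg _)]
        ring
      · fun_prop
    · simp [hp]
  · intro m
    split_ifs
    · fun_prop
    · simp

/-- Bayes' formula. Under the common reference measure, integrating the quotient against the total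
mixture over an event of `obsFiltration n` leaves the mixture over the changed configurations. -/
theorem posterior_ae_eq (hM : N.BoundedLLR M) (hM0 : 0 ≤ M) (h : N.IsRealization P lam X)
    (S : Finset (Fin d)) (n : ℕ) :
    h.posterior S n =ᵐ[P] fun ω =>
      (h.mixLik M (fun m => Changed m S n) n ω / h.mixLik M (fun _ => True) n ω).toReal := by
  set c := h.mixLik M (fun m => Changed m S n) n with hc
  set b := h.mixLik M (fun _ => True) n with hb
  have hcm : Measurable[h.obsFiltration n] c := h.measurable_mixLik _ _
  have hbm : Measurable[h.obsFiltration n] b := h.measurable_mixLik _ _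
  have hbt : ∀ ω, b ω ≠ ∞ := fun ω => h.mixLik_ne_top hM0 _ _ _
  have hb0 : ∀ ω, b ω ≠ 0 := fun ω => h.mixLik_true_ne_zero _ _
  have hcb : ∀ ω, c ω / b ω ≤ 1 := fun ω => ENNReal.div_le_of_le_mul (by
    rw [one_mul, hb, ← h.mixLik_add_not (fun m => Changed m S n)]; exact le_self_add)
  have hdm : Measurable[h.obsFiltration n] fun ω => c ω / b ω := hcm.div hbm
  have hset : {ω | h.phi S ω ≤ n} = {ω | Changed (fun j => lam j ω) S n} := by
    ext ω
    rw [Set.mem_ofPred_eq, Set.mem_ofPred_eq, ← not_lt, h.coe_lt_phi_iff]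
    push Not; rfl
  have hsm : MeasurableSet {ω | h.phi S ω ≤ n} := by
    rw [hset]
    exact h.measurable_lamVec (MeasurableSet.of_discrete (s := {m | Changed m S n}))
  refine (ae_eq_condExp_of_forall_setIntegral_eq (h.obsFiltration.le n) ?_ ?_ ?_ ?_).symm
  · exact (integrable_const 1).indicator hsm
  · intro s _ _
    refine Integrable.integrableOn (Integrable.of_bound (C := 1)
      (hdm.mono (h.obsFiltration.le n) le_rfl).ennreal_toReal.aestronglyMeasurable
      (Eventually.of_forall fun ω => ?_))
    rw [Real.norm_of_nonneg ENNReal.toReal_nonneg]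
    exact ENNReal.toReal_le_of_le_ofReal zero_le_one (by simpa using hcb ω)
  · intro A hA _
    have hA' := h.obsFiltration.le n A hA
    rw [integral_toReal (hdm.mono (h.obsFiltration.le n) le_rfl).aemeasurable
      (Eventually.of_forall fun ω => (hcb ω).trans_lt ENNReal.one_lt_top),
      setIntegral_indicator hsm, setIntegral_const, smul_eq_mul, mul_one, Measure.real]
    congr 1
    classical
    have h1 := lintegral_ite_eq_mixLik hM hM0 h (fun _ => True) (n := n)
      (F := A.indicator fun ω => c ω / b ω) (hdm.indicator hA)
    have h2 := lintegral_ite_eq_mixLik hM hM0 h (fun m => Changed m S n) (n := n)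
      (F := A.indicator fun _ => 1) (measurable_const.indicator hA)
    simp only [if_true] at h1
    rw [← lintegral_indicator hA', h1, ← lintegral_indicator_one (hA'.inter hsm)]
    have h3 : ∀ ω, (if Changed (fun j => lam j ω) S n then A.indicator (fun _ => (1 : ℝ≥0∞)) ω
        else 0) = (A ∩ {ω | h.phi S ω ≤ n}).indicator 1 ω := by
      intro ω
      have hmem : ω ∈ A ∩ {ω | h.phi S ω ≤ n} ↔ ω ∈ A ∧ Changed (fun j => lam j ω) S n := by
        rw [hset]; rfl
      rw [Set.indicator_apply, Set.indicator_apply]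
      simp only [hmem, Pi.one_apply]
      by_cases h1 : Changed (fun j => lam j ω) S n
      · by_cases h2 : ω ∈ A
        · rw [if_pos h1, if_pos h2, if_pos ⟨h2, h1⟩]
        · rw [if_pos h1, if_neg h2, if_neg fun hh : ω ∈ A ∧ Changed _ S n => h2 hh.1]
      · rw [if_neg h1, if_neg fun hh : ω ∈ A ∧ Changed _ S n => h1 hh.2]
    rw [← lintegral_congr h3, h2]
    refine lintegral_congr fun ω => ?_
    by_cases hω : ω ∈ A
    · simp only [Set.indicator_of_mem hω, mul_one]
      rw [mul_left_comm, ← hb, ENNReal.mul_div_cancel (hb0 ω) (hbt ω), mul_comm]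
    · simp [Set.indicator_of_notMem hω]
  · exact hdm.ennreal_toReal.stronglyMeasurable.aestronglyMeasurable

end IsRealization

end ChangePointNetwork

/-! ### Truncated stopping times, Wald's identity and optional stopping. -/

section StoppedTime

variable {Ω : Type*}

/-- The number of observation times up to `n ∧ τ`. -/
noncomputable def stoppedTime (τ : Ω → ℕ∞) (n : ℕ) (ω : Ω) : ℕ := (min (τ ω) n).toNat

theorem coe_stoppedTime (τ : Ω → ℕ∞) (n : ℕ) (ω : Ω) :
    (stoppedTime τ n ω : ℕ∞) = min (τ ω) n :=
  ENat.natCast_toNat (ne_top_of_le_ne_top (ENat.natCast_ne_top n) (min_le_right _ _))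

theorem mem_Icc_stoppedTime_iff (τ : Ω → ℕ∞) (n : ℕ) (ω : Ω) (t : ℕ) :
    t ∈ Finset.Icc 1 (stoppedTime τ n ω) ↔ t ∈ Finset.Icc 1 n ∧ (t : ℕ∞) ≤ τ ω := by
  have : t ≤ stoppedTime τ n ω ↔ (t : ℕ∞) ≤ τ ω ∧ t ≤ n := by
    rw [← Nat.cast_le (α := ℕ∞), coe_stoppedTime, le_min_iff, Nat.cast_le]
  rw [Finset.mem_Icc, Finset.mem_Icc, this]
  tauto

theorem stoppedTime_le (τ : Ω → ℕ∞) (n : ℕ) (ω : Ω) : stoppedTime τ n ω ≤ n := by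
  rw [← Nat.cast_le (α := ℕ∞), coe_stoppedTime]
  exact min_le_right _ _

theorem stoppedTime_of_lt {τ : Ω → ℕ∞} {n : ℕ} {ω : Ω} (hω : (n : ℕ∞) < τ ω) :
    stoppedTime τ n ω = n := by
  rw [← Nat.cast_inj (R := ℕ∞), coe_stoppedTime, min_eq_right hω.le]

theorem stoppedTime_succ_of_not_lt {τ : Ω → ℕ∞} {n : ℕ} {ω : Ω} (hω : ¬ (n : ℕ∞) < τ ω) :
    stoppedTime τ (n + 1) ω = stoppedTime τ n ω := by
  rw [not_lt] at hω
  rw [← Nat.cast_inj (R := ℕ∞), coe_stoppedTime, coe_stoppedTime, min_eq_left hω,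
    min_eq_left (hω.trans (by exact_mod_cast Nat.le_succ n))]

end StoppedTime

namespace ChangePointNetwork

variable {d : ℕ} {𝒳 : Type*} [MeasurableSpace 𝒳] {N : ChangePointNetwork d 𝒳} {M : ℝ}

namespace IsRealization

variable {Ω : Type*} [mΩ : MeasurableSpace Ω] {P : Measure Ω}
  {lam : Fin d → Ω → ℕ} {X : Finset (Fin d) → ℕ → Ω → 𝒳}

theorem measurableSet_gt (h : N.IsRealization P lam X) {τ : Ω → ℕ∞}
    (hτ : IsStoppingTime h.obsFiltration τ) (n : ℕ) :
    MeasurableSet[h.obsFiltration n] {ω | (n : ℕ∞) < τ ω} := by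
  have := (hτ n).compl
  convert this using 1
  ext ω
  simp only [Set.mem_compl_iff, Set.mem_ofPred_eq]
  exact not_le.symm

theorem measurable_ite_llr (h : N.IsRealization P lam X) {τ : Ω → ℕ∞}
    (hτ : IsStoppingTime h.obsFiltration τ) {e : Finset (Fin d)} (he : e ∈ extEdges N.graph) (n : ℕ)
    (a : (Fin d → ℕ) → Prop) [DecidablePred a] (c : ℝ) :
    Measurable fun ω => if (n : ℕ∞) < τ ω ∧ a (fun j => lam j ω) then
      N.llr M e (X e (n + 1) ω) - c else 0 := by
  refine Measurable.ite ?_ ?_ measurable_const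
  · exact (h.obsFiltration.le n _ (h.measurableSet_gt hτ n)).inter
      (h.measurable_lamVec (MeasurableSet.of_discrete (s := {m | a m})))
  · exact ((measurable_llr he).comp (h.measurable_obs e he _ (by omega))).sub_const c

/-- The sum of the log-likelihood ratios, up to time `n`, of the observations selected by `a`. -/
noncomputable def score (_h : N.IsRealization P lam X) (M : ℝ)
    (a : (Fin d → ℕ) → Finset (Fin d) → ℕ → Prop) (n : ℕ) (ω : Ω) : ℝ :=
  open Classical in
  ∑ e ∈ extEdges N.graph, ∑ t ∈ Finset.Icc 1 n,
    if a (fun j => lam j ω) e t then N.llr M e (X e t ω) else 0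

variable (N) in
/-- The compensator of the sum of the log-likelihood ratios of the observations selected by `a`. -/
noncomputable def scoreComp (a : Finset (Fin d) → ℕ → Prop) (n : ℕ) : ℝ :=
  open Classical in
  ∑ e ∈ extEdges N.graph, N.info e * ((Finset.Icc 1 n).filter (a e)).card

/-- Trades the random upper limit for an indicator: observation `t + 1` is used exactly when `t <
τ`, an event known at time `t`. The terms on the right then have mean zero one by one. -/
theorem score_sub_scoreComp (h : N.IsRealization P lam X)
    (a : (Fin d → ℕ) → Finset (Fin d) → ℕ → Prop) [∀ m e t, Decidable (a m e t)] (τ : Ω → ℕ∞)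
    (n : ℕ) (ω : Ω) :
    h.score M a (stoppedTime τ n ω) ω - scoreComp N (a fun j => lam j ω) (stoppedTime τ n ω) =
    ∑ e ∈ extEdges N.graph, ∑ t ∈ Finset.range n,
      if (t : ℕ∞) < τ ω ∧ a (fun j => lam j ω) e (t + 1) then
        N.llr M e (X e (t + 1) ω) - N.info e else 0 := by
  classical
  rw [score, scoreComp, ← Finset.sum_sub_distrib]
  refine Finset.sum_congr rfl fun e _ => ?_
  have h1 : Finset.Icc 1 (stoppedTime τ n ω) =
      (Finset.Icc 1 n).filter fun t : ℕ => (t : ℕ∞) ≤ τ ω := by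
    ext t; rw [mem_Icc_stoppedTime_iff, Finset.mem_filter]
  have h2 : ∑ t ∈ Finset.range n, (if (t : ℕ∞) < τ ω ∧ a (fun j => lam j ω) e (t + 1) then
        N.llr M e (X e (t + 1) ω) - N.info e else 0) =
      ∑ t ∈ Finset.Icc 1 n, (if (t : ℕ∞) ≤ τ ω ∧ a (fun j => lam j ω) e t then
        N.llr M e (X e t ω) - N.info e else 0) := by
    rw [Finset.range_eq_Ico]
    have := Finset.sum_Ico_add' (fun t : ℕ => if (t : ℕ∞) ≤ τ ω ∧ a (fun j => lam j ω) e t then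
        N.llr M e (X e t ω) - N.info e else 0) 0 n 1
    simp only [Nat.cast_add, Nat.cast_one, ENat.add_one_le_iff (ENat.natCast_ne_top _)] at this
    rw [this]; rfl
  rw [h2, Finset.cast_card, Finset.mul_sum, Finset.sum_filter, h1, Finset.sum_filter,
    Finset.sum_filter, ← Finset.sum_sub_distrib]
  refine Finset.sum_congr rfl fun t _ => ?_
  by_cases h3 : (t : ℕ∞) ≤ τ ω <;> by_cases h4 : a (fun j => lam j ω) e t <;> simp [h3, h4]

variable [IsProbabilityMeasure P]

theorem indep_obsFiltration (h : N.IsRealization P lam X) {m : Fin d → ℕ} (hm : ∀ j, 1 ≤ m j)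
    {e : Finset (Fin d)} (he : e ∈ extEdges N.graph) (n : ℕ) :
    Indep (h.obsFiltration n) (MeasurableSpace.comap (X e (n + 1)) inferInstance)
      (h.condLaw m) := by
  have hI := (h.iIndepFun_obs hm).iIndep
  have hd : Disjoint {i : ↥(extEdges N.graph) × ℕ | i.2 < n} {(⟨e, he⟩, n)} := by
    rw [Set.disjoint_singleton_right]
    simp
  have := indep_iSup_of_disjoint
    (fun i => (h.measurable_obs _ i.1.2 (i.2 + 1) (by omega)).comap_le) hI hd
  refine indep_of_indep_of_le_left (indep_of_indep_of_le_right this ?_) ?_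
  · simp
  · refine iSup₂_le fun e' he' => iSup₂_le fun t ht => ?_
    obtain ⟨ht1, ht2⟩ := Finset.mem_Icc.1 ht
    obtain ⟨s, rfl⟩ : ∃ s, t = s + 1 := ⟨t - 1, by omega⟩
    exact le_iSup₂_of_le (f := fun (i : ↥(extEdges N.graph) × ℕ)
      (_ : i ∈ {i : ↥(extEdges N.graph) × ℕ | i.2 < n}) =>
      MeasurableSpace.comap (X i.1 (i.2 + 1)) inferInstance) (⟨e', he'⟩, s) ht2 le_rfl

theorem integrable_ite_llr (hM0 : 0 ≤ M) (h : N.IsRealization P lam X) {τ : Ω → ℕ∞}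
    (hτ : IsStoppingTime h.obsFiltration τ) {e : Finset (Fin d)} (he : e ∈ extEdges N.graph) (n : ℕ)
    (a : (Fin d → ℕ) → Prop) [DecidablePred a] (c : ℝ) :
    Integrable (fun ω => if (n : ℕ∞) < τ ω ∧ a (fun j => lam j ω) then
      N.llr M e (X e (n + 1) ω) - c else 0) P := by
  refine Integrable.of_bound (C := M + |c|) (h.measurable_ite_llr hτ he n a c).aestronglyMeasurable
    (Eventually.of_forall fun ω => ?_)
  rw [Real.norm_eq_abs]
  split_ifs
  · exact (abs_sub _ _).trans (add_le_add_left (abs_llr_le hM0 _ _) _)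
  · rw [abs_zero]; positivity

/-- Given the change points, `{n < τ}` belongs to the past and is independent of the observation at
`n + 1`. Its log-likelihood ratio has mean `info e` there, because `a` selects only configurations
in which `e` has changed. -/
theorem integral_ite_llr (hM : N.BoundedLLR M) (hM0 : 0 ≤ M) (h : N.IsRealization P lam X)
    {τ : Ω → ℕ∞} (hτ : IsStoppingTime h.obsFiltration τ) {e : Finset (Fin d)}
    (he : e ∈ extEdges N.graph) (n : ℕ) (a : (Fin d → ℕ) → Prop) [DecidablePred a]
    (ha : ∀ m, a m → Changed m e (n + 1)) :
    ∫ ω, (if (n : ℕ∞) < τ ω ∧ a (fun j => lam j ω) then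
      N.llr M e (X e (n + 1) ω) - N.info e else 0) ∂P = 0 := by
  have hint := h.integrable_ite_llr hM0 hτ he n a (N.info e)
  have hgt := h.obsFiltration.le n _ (h.measurableSet_gt hτ n)
  have hX := h.measurable_obs e he (n + 1) (by omega)
  rw [← setIntegral_univ, ← h.iUnion_fiber,
    integral_iUnion h.measurableSet_fiber h.pairwise_disjoint_fiber hint.integrableOn]
  refine (tsum_congr (g := fun _ => (0 : ℝ)) fun m => ?_).trans tsum_zero
  by_cases hm : N.priorWeight m = 0
  · rw [h.restrict_fiber, hm]; simp
  have hm1 := N.one_le_of_priorWeight_ne_zero hm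
  have := h.isProbabilityMeasure_condLaw hm1
  have hcongr : ∫ ω in h.fiber m, (if (n : ℕ∞) < τ ω ∧ a (fun j => lam j ω) then
      N.llr M e (X e (n + 1) ω) - N.info e else 0) ∂P =
      ∫ ω in h.fiber m, (if (n : ℕ∞) < τ ω ∧ a m then
      N.llr M e (X e (n + 1) ω) - N.info e else 0) ∂P := by
    refine setIntegral_congr_fun (h.measurableSet_fiber m) fun ω hω => ?_
    have : (fun j => lam j ω) = m := funext hω
    simp only [this]
  rw [hcongr, h.restrict_fiber, integral_smul_measure]
  by_cases hc : a m
  · simp only [hc, and_true]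
    have h1 : ∀ ω, (if (n : ℕ∞) < τ ω then N.llr M e (X e (n + 1) ω) - N.info e else 0) =
        {ω | (n : ℕ∞) < τ ω}.indicator (fun ω => N.llr M e (X e (n + 1) ω) - N.info e) ω := by
      intro ω; rw [Set.indicator_apply]; rfl
    rw [integral_congr_ae (Eventually.of_forall h1), integral_indicator hgt,
      (h.indep_obsFiltration hm1 he n).setIntegral_eq_mul (h.obsFiltration.le n)
        (f := fun x => N.llr M e x - N.info e) hX.aemeasurable (h.measurableSet_gt hτ n)
        ((measurable_llr he).sub_const _).aestronglyMeasurable,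
      ← integral_map (φ := X e (n + 1)) (f := fun x => N.llr M e x - N.info e) hX.aemeasurable
        ((measurable_llr he).sub_const _).aestronglyMeasurable,
      h.map_obs hm1 he (by omega)]
    have := isProbabilityMeasure_obsLaw (N := N) he m (n + 1)
    rw [integral_sub (integrable_llr hM0 he _ _) (integrable_const _),
      hM.integral_llr hM0 he (ha m hc)]
    simp
  · simp [hc]

theorem integrable_score_sub (hM0 : 0 ≤ M) (h : N.IsRealization P lam X) {τ : Ω → ℕ∞}
    (hτ : IsStoppingTime h.obsFiltration τ) (a : (Fin d → ℕ) → Finset (Fin d) → ℕ → Prop) (n : ℕ) :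
    Integrable (fun ω => h.score M a (stoppedTime τ n ω) ω -
      scoreComp N (a fun j => lam j ω) (stoppedTime τ n ω)) P := by
  classical
  simp_rw [h.score_sub_scoreComp a τ n]
  exact integrable_finsetSum _ fun e he => integrable_finsetSum _ fun t _ =>
    h.integrable_ite_llr hM0 hτ he t (fun m => a m e (t + 1)) _

/-- Wald's identity for the log-likelihood ratios of affected observations. -/
theorem integral_score_sub (hM : N.BoundedLLR M) (hM0 : 0 ≤ M) (h : N.IsRealization P lam X)
    {τ : Ω → ℕ∞} (hτ : IsStoppingTime h.obsFiltration τ)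
    {a : (Fin d → ℕ) → Finset (Fin d) → ℕ → Prop} (ha : ∀ m e t, a m e t → Changed m e t) (n : ℕ) :
    ∫ ω, (h.score M a (stoppedTime τ n ω) ω -
      scoreComp N (a fun j => lam j ω) (stoppedTime τ n ω)) ∂P = 0 := by
  classical
  simp_rw [h.score_sub_scoreComp a τ n]
  rw [integral_finsetSum _ fun e he => integrable_finsetSum _ fun t _ =>
    h.integrable_ite_llr hM0 hτ he t (fun m => a m e (t + 1)) _]
  refine Finset.sum_eq_zero fun e he => ?_
  rw [integral_finsetSum _ fun t _ =>
    h.integrable_ite_llr hM0 hτ he t (fun m => a m e (t + 1)) _]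
  exact Finset.sum_eq_zero fun t _ => integral_ite_llr hM hM0 h hτ he t (fun m => a m e (t + 1))
    fun m => ha m e (t + 1)

/-- Optional stopping for the product martingale with factors of conditional mean one. -/
theorem lintegral_prod_stoppedTime (h : N.IsRealization P lam X) {m : Fin d → ℕ}
    (hm : ∀ j, 1 ≤ m j) {u : Finset (Fin d) → ℕ → 𝒳 → ℝ≥0∞} (hu : ∀ e t, Measurable (u e t))
    (hu1 : ∀ e ∈ extEdges N.graph, ∀ t, 1 ≤ t → ∫⁻ x, u e t x ∂(N.obsLaw m e t) = 1)
    {τ : Ω → ℕ∞} (hτ : IsStoppingTime h.obsFiltration τ) (n : ℕ) :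
    ∫⁻ ω, ∏ e ∈ extEdges N.graph, ∏ t ∈ Finset.Icc 1 (stoppedTime τ n ω), u e t (X e t ω)
      ∂(h.condLaw m) = 1 := by
  classical
  have := h.isProbabilityMeasure_condLaw hm
  set Z : ℕ → Ω → ℝ≥0∞ := fun k ω =>
    ∏ e ∈ extEdges N.graph, ∏ t ∈ Finset.Icc 1 k, u e t (X e t ω) with hZ
  have hZm : ∀ k, Measurable[h.obsFiltration k] (Z k) := fun k =>
    h.measurable_prod_obs k fun e _ t => hu e t
  change ∫⁻ ω, Z (stoppedTime τ n ω) ω ∂(h.condLaw m) = 1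
  induction n with
  | zero =>
    have : ∀ ω, Z (stoppedTime τ 0 ω) ω = 1 := by
      intro ω
      have : stoppedTime τ 0 ω = 0 := by simp [stoppedTime]
      simp [hZ, this]
    simp [this]
  | succ n ih =>
    rw [← ih]
    have hA := h.measurableSet_gt hτ n
    have hA' := h.obsFiltration.le n _ hA
    rw [← lintegral_add_compl _ hA', ← lintegral_add_compl (fun ω => Z (stoppedTime τ n ω) ω) hA']
    congr 1
    · have h1 : ∫⁻ ω in {ω | (n : ℕ∞) < τ ω}, Z (stoppedTime τ (n + 1) ω) ω ∂(h.condLaw m) =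
          ∫⁻ ω in {ω | (n : ℕ∞) < τ ω}, Z (n + 1) ω ∂(h.condLaw m) := by
        refine setLIntegral_congr_fun hA' fun ω hω => ?_
        have : stoppedTime τ (n + 1) ω = n + 1 := by
          rw [← Nat.cast_inj (R := ℕ∞), coe_stoppedTime, min_eq_right]
          exact_mod_cast Order.add_one_le_of_lt (show (n : ℕ∞) < τ ω from hω)
        simp only [this]
      have h2 : ∫⁻ ω in {ω | (n : ℕ∞) < τ ω}, Z (stoppedTime τ n ω) ω ∂(h.condLaw m) =
          ∫⁻ ω in {ω | (n : ℕ∞) < τ ω}, Z n ω ∂(h.condLaw m) :=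
        setLIntegral_congr_fun hA' fun ω hω => by simp only [stoppedTime_of_lt hω]
      rw [h1, h2, ← lintegral_indicator hA', ← lintegral_indicator hA']
      -- Only the new factor at time `n + 1` is kept. It has mean one, so weighting by it leaves the
      -- law on `obsFiltration n` unchanged, which is `trim_withDensity` with `m' = m`.
      set v : Finset (Fin d) → ℕ → 𝒳 → ℝ≥0∞ := fun e t => if t ≤ n then 1 else u e t with hv
      have hvm : ∀ e t, Measurable (v e t) := by
        intro e t
        simp only [hv]
        split_ifs
        · exact measurable_one
        · exact hu e t
      have key := h.trim_withDensity hm hm n.le_succ hvm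
        (fun e _ t ht => by
          simp only [hv, if_pos (Finset.mem_Icc.1 ht).2]; exact withDensity_one)
        (fun e he t ht => by
          rw [Finset.mem_Ioc] at ht
          simp only [hv, if_neg (by omega : ¬ t ≤ n)]
          exact hu1 e he t (by omega))
      have hFm := (hZm n).indicator hA
      rw [← lintegral_trim (h.obsFiltration.le n) hFm, ← key, lintegral_trim _ hFm,
        lintegral_withDensity_eq_lintegral_mul _
          ((h.measurable_prod_obs (n + 1) fun e _ t => hvm e t).mono (h.obsFiltration.le _) le_rfl)
          (hFm.mono (h.obsFiltration.le n) le_rfl)]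
      refine lintegral_congr fun ω => ?_
      rw [Pi.mul_apply]
      by_cases hω : ω ∈ {ω | (n : ℕ∞) < τ ω}
      · rw [Set.indicator_of_mem hω, Set.indicator_of_mem hω, hZ, ← Finset.prod_mul_distrib]
        refine Finset.prod_congr rfl fun e _ => ?_
        rw [Finset.prod_Icc_succ_top (by omega), Finset.prod_Icc_succ_top (by omega), mul_comm,
          Finset.prod_eq_one (s := Finset.Icc 1 n) (f := fun t => v e t (X e t ω))
          (fun t ht => by simp only [hv, if_pos (Finset.mem_Icc.1 ht).2, Pi.one_apply])]
        simp [hv]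
      · rw [Set.indicator_of_notMem hω, Set.indicator_of_notMem hω, mul_zero]
    · exact setLIntegral_congr_fun hA'.compl fun ω hω => by
        simp only [stoppedTime_succ_of_not_lt hω]

end IsRealization

end ChangePointNetwork

/-! ### The linear compensator and the delay identity. -/

theorem minOver_eq_inf' {d : ℕ} {S : Finset (Fin d)} (hS : S.Nonempty) (m : Fin d → ℕ) :
    minOver S m = (S.inf' hS m : ℕ) := by
  apply le_antisymm
  · obtain ⟨j, hj, hjm⟩ := S.exists_mem_eq_inf' hS m
    rw [hjm]
    exact Finset.inf_le hj
  · exact Finset.le_inf fun j hj => by exact_mod_cast Finset.inf'_le m hj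

namespace ChangePointNetwork

variable {d : ℕ} {𝒳 : Type*} [MeasurableSpace 𝒳] {N : ChangePointNetwork d 𝒳} {M : ℝ}

/-- The observations that distinguish the configuration `m` from the one in which the change points
in `S` are delayed beyond the horizon. -/
def Distinguishing (S : Finset (Fin d)) (m : Fin d → ℕ) (e : Finset (Fin d)) (t : ℕ) : Prop :=
  Changed m e t ∧ ¬ Changed m (e \ S) t

/-- The post-change observations on the nodes and edges inside `S`. -/
def ChangedInside (S : Finset (Fin d)) (m : Fin d → ℕ) (e : Finset (Fin d)) (t : ℕ) : Prop :=
  e ⊆ S ∧ Changed m e t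

theorem distinguishing_iff {S e : Finset (Fin d)} (he : e ⊆ S) (m : Fin d → ℕ) (t : ℕ) :
    Distinguishing S m e t ↔ Changed m e t := by
  simp [Distinguishing, Finset.sdiff_eq_empty_iff_subset.2 he]

theorem changedInside_iff {S e : Finset (Fin d)} (he : e ⊆ S) (m : Fin d → ℕ) (t : ℕ) :
    ChangedInside S m e t ↔ Changed m e t := by
  simp [ChangedInside, he]

open IsRealization in
-- Inside `S` each edge is selected at essentially all times after `φ`, and outside `S` only for a
-- period bounded by a change point, so the compensator grows like `I (k - φ)`. The hypotheses on
-- `a` cover both `Distinguishing` and `ChangedInside`. The error is uniform in `k`, so it survives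
-- evaluation at any stopping time.
theorem BoundedLLR.abs_scoreComp_sub_le (hM : N.BoundedLLR M) (hM0 : 0 ≤ M) {S : Finset (Fin d)}
    (hS : S.Nonempty) (m : Fin d → ℕ) {a : Finset (Fin d) → ℕ → Prop}
    (ha1 : ∀ e ⊆ S, ∀ t, a e t ↔ Changed m e t)
    (ha2 : ∀ e, ¬ e ⊆ S → ∀ t, a e t → ¬ Changed m (e \ S) t) (k : ℕ) :
    |N.priorRate S * k + scoreComp N a k -
      (N.priorRate S + N.totalInfo S) * ((k - S.inf' hS m : ℕ) : ℝ)| ≤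
      (N.priorRate S + (extEdges N.graph).card * M) * (1 + ∑ j, (m j : ℝ)) := by
  classical
  set φ := S.inf' hS m with hφ
  -- A crude integrable majorant of every change point, hence of `φ` and of each `λ_e`.
  set Λ : ℕ := ∑ j, m j with hΛ
  have hle : ∀ j, m j ≤ Λ := fun j => Finset.single_le_sum (fun _ _ => Nat.zero_le _)
    (Finset.mem_univ j)
  have hφΛ : φ ≤ Λ := by
    obtain ⟨j, hj, hjm⟩ := S.exists_mem_eq_inf' hS m
    rw [hφ, hjm]; exact hle j
  have hcount : ∀ e ∈ extEdges N.graph,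
      |((((Finset.Icc 1 k).filter (a e)).card : ℕ) : ℝ) -
        (if e ⊆ S then ((k - φ : ℕ) : ℝ) else 0)| ≤ 1 + (Λ : ℝ) := by
    -- For `e ⊆ S` selection starts at `λ_e`, which lies between `φ` and `Λ`; time `φ` itself
    -- accounts for the `1`. Otherwise some `j ∈ e \ S` ends the selection by time `m j`.
    intro e he
    by_cases heS : e ⊆ S
    · obtain ⟨j, hj⟩ := nonempty_of_mem_extEdges he
      have h1 : ((Finset.Icc 1 k).filter (a e)).card ≤ k - φ + 1 := by
        calc _ ≤ (Finset.Icc φ k).card := by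
              refine Finset.card_le_card fun t ht => ?_
              rw [Finset.mem_filter, Finset.mem_Icc, ha1 e heS] at ht
              obtain ⟨i, hi, hit⟩ := ht.2
              exact Finset.mem_Icc.2 ⟨(Finset.inf'_le m (heS hi)).trans hit, ht.1.2⟩
          _ ≤ _ := by rw [Nat.card_Icc]; omega
      have h2 : k - φ ≤ ((Finset.Icc 1 k).filter (a e)).card + Λ := by
        have : (Finset.Icc (m j + 1) k).card ≤ ((Finset.Icc 1 k).filter (a e)).card := by
          refine Finset.card_le_card fun t ht => ?_
          rw [Finset.mem_Icc] at ht
          rw [Finset.mem_filter, Finset.mem_Icc, ha1 e heS]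
          exact ⟨⟨by omega, ht.2⟩, j, hj, by omega⟩
        rw [Nat.card_Icc] at this
        have := hle j
        omega
      rw [if_pos heS, abs_le]
      have h1' : ((((Finset.Icc 1 k).filter (a e)).card : ℕ) : ℝ) ≤ ((k - φ : ℕ) : ℝ) + 1 := by
        exact_mod_cast h1
      have h2' : ((k - φ : ℕ) : ℝ) ≤ ((((Finset.Icc 1 k).filter (a e)).card : ℕ) : ℝ) + Λ := by
        exact_mod_cast h2
      have : (0 : ℝ) ≤ Λ := Nat.cast_nonneg _
      constructor <;> linarith
    · obtain ⟨j, hj, hjS⟩ := Finset.not_subset.1 heS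
      have h1 : ((Finset.Icc 1 k).filter (a e)).card ≤ Λ := by
        calc _ ≤ (Finset.Icc 1 (m j)).card := by
              refine Finset.card_le_card fun t ht => ?_
              rw [Finset.mem_filter, Finset.mem_Icc] at ht
              rw [Finset.mem_Icc]
              refine ⟨ht.1.1, ?_⟩
              by_contra hc
              exact ha2 e heS t ht.2 ⟨j, Finset.mem_sdiff.2 ⟨hj, hjS⟩, by omega⟩
          _ ≤ _ := by rw [Nat.card_Icc]; have := hle j; omega
      have h1' : ((((Finset.Icc 1 k).filter (a e)).card : ℕ) : ℝ) ≤ Λ := by exact_mod_cast h1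
      rw [if_neg heS, sub_zero, abs_of_nonneg (Nat.cast_nonneg _)]
      linarith
  have hq := priorRate_pos (N := N) hS
  have hcast : (∑ j, (m j : ℝ)) = Λ := by rw [hΛ]; push_cast; rfl
  have hI : N.totalInfo S = ∑ e ∈ extEdges N.graph, if e ⊆ S then N.info e else 0 := by
    rw [totalInfo, Finset.sum_filter]
  have hsplit : N.priorRate S * k + scoreComp N a k -
      (N.priorRate S + N.totalInfo S) * ((k - φ : ℕ) : ℝ) =
      N.priorRate S * (k - ((k - φ : ℕ) : ℝ)) + ∑ e ∈ extEdges N.graph, N.info e *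
        (((((Finset.Icc 1 k).filter (a e)).card : ℕ) : ℝ) -
        (if e ⊆ S then ((k - φ : ℕ) : ℝ) else 0)) := by
    simp only [mul_sub, Finset.sum_sub_distrib]
    rw [add_mul, hI, Finset.sum_mul]
    have : ∀ e ∈ extEdges N.graph, (if e ⊆ S then N.info e else 0) * ((k - φ : ℕ) : ℝ) =
        N.info e * (if e ⊆ S then ((k - φ : ℕ) : ℝ) else 0) := by
      intro e _; split_ifs <;> simp
    rw [Finset.sum_congr rfl this]
    have : scoreComp N a k = ∑ e ∈ extEdges N.graph, N.info e *
        ((((Finset.Icc 1 k).filter (a e)).card : ℕ) : ℝ) := by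
      rw [scoreComp]
    rw [this]
    ring
  rw [hsplit, hcast]
  refine (abs_add_le _ _).trans ?_
  rw [add_mul]
  refine add_le_add ?_ ?_
  · rw [abs_mul, abs_of_pos hq]
    refine mul_le_mul_of_nonneg_left ?_ hq.le
    have h1 : (k : ℝ) ≤ ((k - φ : ℕ) : ℝ) + Λ := by
      have : k ≤ k - φ + Λ := by omega
      exact_mod_cast this
    have h2 : ((k - φ : ℕ) : ℝ) ≤ k := by exact_mod_cast Nat.sub_le k φ
    rw [abs_of_nonneg (by linarith)]
    linarith
  · refine (Finset.abs_sum_le_sum_abs _ _).trans ?_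
    refine (Finset.sum_le_card_nsmul _ _ (M * (1 + (Λ : ℝ))) fun e he => ?_).trans
      (by rw [nsmul_eq_mul, mul_assoc])
    rw [abs_mul]
    exact mul_le_mul (hM.abs_info_le hM0 he (nonempty_of_mem_extEdges he)) (hcount e he)
      (abs_nonneg _) hM0

open IsRealization in
theorem BoundedLLR.abs_scoreComp_le (hM : N.BoundedLLR M) (hM0 : 0 ≤ M)
    (a : Finset (Fin d) → ℕ → Prop) (k : ℕ) :
    |scoreComp N a k| ≤ (extEdges N.graph).card * (k * M) := by
  classical
  rw [scoreComp]
  refine (Finset.abs_sum_le_sum_abs _ _).trans ?_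
  refine (Finset.sum_le_card_nsmul _ _ (k * M) fun e he => ?_).trans (by rw [nsmul_eq_mul])
  rw [abs_mul, mul_comm]
  refine mul_le_mul ?_ (hM.abs_info_le hM0 he (nonempty_of_mem_extEdges he)) (abs_nonneg _)
    (Nat.cast_nonneg _)
  rw [abs_of_nonneg (Nat.cast_nonneg _)]
  exact_mod_cast (Finset.card_filter_le _ _).trans (by simp)

namespace IsRealization

variable {Ω : Type*} [mΩ : MeasurableSpace Ω] {P : Measure Ω}
  {lam : Fin d → Ω → ℕ} {X : Finset (Fin d) → ℕ → Ω → 𝒳}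

theorem abs_score_le (hM0 : 0 ≤ M) (h : N.IsRealization P lam X)
    (a : (Fin d → ℕ) → Finset (Fin d) → ℕ → Prop) (k : ℕ) (ω : Ω) :
    |h.score M a k ω| ≤ (extEdges N.graph).card * (k * M) := by
  unfold score
  refine (Finset.abs_sum_le_sum_abs _ _).trans ?_
  refine (Finset.sum_le_card_nsmul _ _ (k * M) fun e he => ?_).trans (by rw [nsmul_eq_mul])
  refine (Finset.abs_sum_le_sum_abs _ _).trans ?_
  refine (Finset.sum_le_card_nsmul _ _ M fun t ht => ?_).trans (by simp)
  split_ifs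
  · exact abs_llr_le hM0 _ _
  · simpa using hM0

theorem phi_eq (h : N.IsRealization P lam X) {S : Finset (Fin d)} (hS : S.Nonempty) (ω : Ω) :
    h.phi S ω = (S.inf' hS fun j => lam j ω : ℕ) := minOver_eq_inf' hS _

theorem measurable_inf' (h : N.IsRealization P lam X) {S : Finset (Fin d)} (hS : S.Nonempty) :
    Measurable fun ω => S.inf' hS fun j => lam j ω :=
  (measurable_of_countable (fun m : Fin d → ℕ => S.inf' hS m)).comp h.measurable_lamVec

/-- Delaying `S` by `k` alters, up to time `k`, exactly the observations whose change is due to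
nodes of `S` alone; on all others the two likelihoods agree. -/
theorem score_distinguishing_eq (h : N.IsRealization P lam X) {ω : Ω} {m : Fin d → ℕ}
    (hω : (fun j => lam j ω) = m) (hm : ∀ j, 1 ≤ m j) (S : Finset (Fin d)) (k : ℕ) :
    h.score M (Distinguishing S) k ω = h.logLik M m k ω - h.logLik M (shift S k m) k ω := by
  unfold score logLik
  rw [hω, ← Finset.sum_sub_distrib]
  refine Finset.sum_congr rfl fun e _ => ?_
  rw [← Finset.sum_sub_distrib]
  refine Finset.sum_congr rfl fun t ht => ?_
  have h1 := changed_shift_iff hm S e (Finset.mem_Icc.1 ht).2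
  have h2 : Changed m (e \ S) t → Changed m e t := fun ⟨j, hj, hjt⟩ =>
    ⟨j, (Finset.mem_sdiff.1 hj).1, hjt⟩
  by_cases c1 : Changed m e t
  · by_cases c2 : Changed m (e \ S) t
    · rw [if_neg fun hh : Distinguishing S m e t => hh.2 c2, if_pos c1, if_pos (h1.2 c2), sub_self]
    · rw [if_pos ⟨c1, c2⟩, if_pos c1, if_neg fun hh => c2 (h1.1 hh), sub_zero]
  · rw [if_neg fun hh : Distinguishing S m e t => c1 hh.1, if_neg c1,
      if_neg fun hh => c1 (h2 (h1.1 hh)), sub_self]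

variable [IsProbabilityMeasure P]

/-- The exponent is the log of the prior factor times the likelihood ratio of the delayed
configuration against the true one. Changing measure fiber by fiber and reindexing by memorylessness
produces the event of no change in `S`. -/
theorem lintegral_exp_score (hM : N.BoundedLLR M) (hM0 : 0 ≤ M) (h : N.IsRealization P lam X)
    (S : Finset (Fin d)) {n : ℕ} {A : Set Ω} (hA : MeasurableSet[h.obsFiltration n] A) :
    ∫⁻ ω in A, ENNReal.ofReal
        (Real.exp (-(N.priorRate S * n + h.score M (Distinguishing S) n ω))) ∂P =
      P (A ∩ {ω | (n : ℕ∞) < h.phi S ω}) := by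
  classical
  have hA' := h.obsFiltration.le n A hA
  have hphi : MeasurableSet {ω | (n : ℕ∞) < h.phi S ω} := by
    simp_rw [h.coe_lt_phi_iff]
    exact h.measurable_lamVec (MeasurableSet.of_discrete (s := {m | ∀ j ∈ S, n < m j}))
  have hAm : Measurable[h.obsFiltration n] (A.indicator fun _ => (1 : ℝ≥0∞)) :=
    measurable_const.indicator hA
  have hl := fun m => (h.measurable_logLik (M := M) m n).mono (h.obsFiltration.le n) le_rfl
  let F₁ : (Fin d → ℕ) → Ω → ℝ≥0∞ := fun m ω =>
    ENNReal.ofReal (Real.exp (-(N.priorRate S * n))) *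
      (ENNReal.ofReal (Real.exp (h.logLik M (shift S n m) n ω - h.logLik M m n ω)) *
        A.indicator (fun _ => 1) ω)
  let F₂ : (Fin d → ℕ) → Ω → ℝ≥0∞ := fun m ω =>
    if ∀ j ∈ S, n < m j then A.indicator (fun _ => (1 : ℝ≥0∞)) ω else 0
  have e1 : ∫⁻ ω in A, ENNReal.ofReal
        (Real.exp (-(N.priorRate S * n + h.score M (Distinguishing S) n ω))) ∂P =
      ∫⁻ ω, F₁ (fun j => lam j ω) ω ∂P := by
    unfold F₁
    rw [← lintegral_indicator hA']
    refine lintegral_congr_ae ?_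
    filter_upwards [h.ae_one_le_lam] with ω hω
    by_cases hωA : ω ∈ A
    · rw [Set.indicator_of_mem hωA, Set.indicator_of_mem hωA, mul_one,
        ← ENNReal.ofReal_mul (Real.exp_nonneg _), ← Real.exp_add,
        h.score_distinguishing_eq rfl hω]
      congr 2
      ring
    · simp [Set.indicator_of_notMem hωA]
  have e3 : P (A ∩ {ω | (n : ℕ∞) < h.phi S ω}) = ∫⁻ ω, F₂ (fun j => lam j ω) ω ∂P := by
    unfold F₂
    rw [← lintegral_indicator_one (hA'.inter hphi)]
    refine lintegral_congr fun ω => ?_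
    have := h.coe_lt_phi_iff S n ω
    simp only [Set.indicator_apply]
    by_cases c1 : ∀ j ∈ S, n < lam j ω
    · by_cases c2 : ω ∈ A
      · rw [if_pos ⟨c2, this.2 c1⟩, if_pos c1, if_pos c2]; rfl
      · rw [if_neg (fun hh => c2 hh.1), if_pos c1, if_neg c2]
    · rw [if_neg (fun hh => c1 (this.1 hh.2)), if_neg c1]
  have e4 := tsum_priorWeight_shift (N := N) S n fun m =>
    ∫⁻ ω, A.indicator (fun _ => (1 : ℝ≥0∞)) ω ∂(h.condLaw m)
  rw [e1, h.lintegral_eq_tsum F₁, e3, h.lintegral_eq_tsum F₂]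
  unfold F₁ F₂
  have e5 : ∀ m, ENNReal.ofReal (N.priorWeight m) * ∫⁻ ω, (if ∀ j ∈ S, n < m j then
      A.indicator (fun _ => (1 : ℝ≥0∞)) ω else 0) ∂(h.condLaw m) =
      (if ∀ j ∈ S, n < m j then ENNReal.ofReal (N.priorWeight m) *
        ∫⁻ ω, A.indicator (fun _ => (1 : ℝ≥0∞)) ω ∂(h.condLaw m) else 0) := by
    intro m; split_ifs <;> simp
  rw [tsum_congr e5, e4, ← ENNReal.tsum_mul_left]
  refine tsum_congr fun m => ?_
  by_cases hm : N.priorWeight m = 0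
  · simp [hm]
  have hm1 := N.one_le_of_priorWeight_ne_zero hm
  rw [lintegral_const_mul _ (by
      have := hAm.mono (h.obsFiltration.le n) le_rfl
      fun_prop),
    lintegral_exp_logLik_mul hM hM0 h hm1 (one_le_shift hm1 S n) hAm]
  ring

/-- Change of measure at a stopping time: the expected reciprocal likelihood ratio is at most the
false-alarm probability. -/
theorem lintegral_exp_score_stopped_le (hM : N.BoundedLLR M) (hM0 : 0 ≤ M)
    (h : N.IsRealization P lam X) (S : Finset (Fin d)) {τ : Ω → ℕ∞}
    (hτ : IsStoppingTime h.obsFiltration τ) :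
    ∫⁻ ω in {ω | τ ω ≠ ⊤}, ENNReal.ofReal (Real.exp (-(N.priorRate S * (τ ω).toNat +
      h.score M (Distinguishing S) (τ ω).toNat ω))) ∂P ≤ P {ω | τ ω < h.phi S ω} := by
  have hτn : ∀ n : ℕ, MeasurableSet[h.obsFiltration n] {ω | τ ω = n} := hτ.measurableSet_eq
  have hτn' := fun n => h.obsFiltration.le n _ (hτn n)
  have hdisj : Pairwise (Function.onFun Disjoint fun n : ℕ => {ω | τ ω = n}) := by
    intro n n' hne
    refine Set.disjoint_left.2 fun ω (h1 : τ ω = n) (h2 : τ ω = n') => hne ?_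
    exact_mod_cast h1.symm.trans h2
  have hU : {ω | τ ω ≠ ⊤} = ⋃ n : ℕ, {ω | τ ω = n} := by
    ext ω
    simp only [Set.mem_ofPred_eq, Set.mem_iUnion]
    rw [ENat.ne_top_iff_exists]
    exact exists_congr fun n => eq_comm
  have hphi : ∀ n : ℕ, MeasurableSet {ω | (n : ℕ∞) < h.phi S ω} := by
    intro n
    simp_rw [h.coe_lt_phi_iff]
    exact h.measurable_lamVec (MeasurableSet.of_discrete (s := {m | ∀ j ∈ S, n < m j}))
  rw [hU, lintegral_iUnion hτn' hdisj]
  have : ∀ n : ℕ, ∫⁻ ω in {ω | τ ω = n}, ENNReal.ofReal (Real.exp (-(N.priorRate S * (τ ω).toNat +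
      h.score M (Distinguishing S) (τ ω).toNat ω))) ∂P =
      P ({ω | τ ω = n} ∩ {ω | (n : ℕ∞) < h.phi S ω}) := by
    intro n
    rw [← lintegral_exp_score hM hM0 h S (hτn n)]
    refine setLIntegral_congr_fun (hτn' n) fun ω hω => ?_
    have hω' : τ ω = n := hω
    simp only [hω', ENat.toNat_natCast]
  rw [tsum_congr this, ← measure_iUnion]
  · refine measure_mono (Set.iUnion_subset fun n ω hω => ?_)
    have hω' : τ ω = n := hω.1
    change τ ω < _
    rw [hω']
    exact hω.2
  · intro n n' hne
    exact (hdisj hne).mono Set.inter_subset_left Set.inter_subset_left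
  · exact fun n => (hτn' n).inter (hphi n)

end IsRealization

end ChangePointNetwork

/-! ### Lower bound for every stopping time with controlled false alarms. -/

theorem integral_le_toReal_lintegral_ofReal {Ω : Type*} [MeasurableSpace Ω] {P : Measure Ω}
    {f : Ω → ℝ} (hf : Integrable f P) :
    ∫ ω, f ω ∂P ≤ (∫⁻ ω, ENNReal.ofReal (f ω) ∂P).toReal := by
  rw [integral_eq_lintegral_pos_part_sub_lintegral_neg_part hf]
  exact sub_le_self _ ENNReal.toReal_nonneg

namespace ChangePointNetwork

variable {d : ℕ} {𝒳 : Type*} [MeasurableSpace 𝒳] {N : ChangePointNetwork d 𝒳} {M : ℝ}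

theorem BoundedLLR.totalInfo_nonneg (hM : N.BoundedLLR M) (hM0 : 0 ≤ M) (S : Finset (Fin d)) :
    0 ≤ N.totalInfo S :=
  Finset.sum_nonneg fun _ he => hM.info_nonneg hM0 (Finset.mem_filter.1 he).1
    (nonempty_of_mem_extEdges (Finset.mem_filter.1 he).1)

theorem BoundedLLR.rate_pos (hM : N.BoundedLLR M) (hM0 : 0 ≤ M) {S : Finset (Fin d)}
    (hS : S.Nonempty) : 0 < N.priorRate S + N.totalInfo S :=
  add_pos_of_pos_of_nonneg (priorRate_pos hS) (hM.totalInfo_nonneg hM0 S)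

namespace IsRealization

variable {Ω : Type*} [mΩ : MeasurableSpace Ω] {P : Measure Ω}
  {lam : Fin d → Ω → ℕ} {X : Finset (Fin d) → ℕ → Ω → 𝒳}

/-- A bound, uniform in the stopping time, for the expected difference between the compensated
log-likelihood and its linear approximation. -/
noncomputable def overhead (_h : N.IsRealization P lam X) (M : ℝ) (S : Finset (Fin d)) : ℝ :=
  (N.priorRate S + (extEdges N.graph).card * M) * (1 + ∑ j, ∫ ω, (lam j ω : ℝ) ∂P)

theorem measurable_of_isStoppingTime (h : N.IsRealization P lam X) {τ : Ω → ℕ∞}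
    (hτ : IsStoppingTime h.obsFiltration τ) : Measurable τ := by
  refine measurable_to_countable' fun x => ?_
  have hn : ∀ n : ℕ, MeasurableSet (τ ⁻¹' {(n : ℕ∞)}) := fun n =>
    h.obsFiltration.le n _ (hτ.measurableSet_eq n)
  induction x using ENat.recTopCoe with
  | top =>
    have : τ ⁻¹' {⊤} = (⋃ n : ℕ, τ ⁻¹' {(n : ℕ∞)})ᶜ := by
      ext ω
      simp only [Set.mem_preimage, Set.mem_singleton_iff, Set.mem_compl_iff, Set.mem_iUnion]
      rw [← not_iff_not, not_not, ← ne_eq, ENat.ne_top_iff_exists]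
      exact exists_congr fun n => eq_comm
    rw [this]
    exact (MeasurableSet.iUnion hn).compl
  | coe n => exact hn n

variable [IsProbabilityMeasure P]

theorem integrable_sum_lam (h : N.IsRealization P lam X) :
    Integrable (fun ω => 1 + ∑ j, (lam j ω : ℝ)) P :=
  (integrable_const 1).add (integrable_finsetSum _ fun j _ => h.integrable_lam j)

theorem integral_sum_lam (h : N.IsRealization P lam X) :
    ∫ ω, (1 + ∑ j, (lam j ω : ℝ)) ∂P = 1 + ∑ j, ∫ ω, (lam j ω : ℝ) ∂P := by
  rw [integral_add (integrable_const 1) (integrable_finsetSum _ fun j _ => h.integrable_lam j),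
    integral_finsetSum _ fun j _ => h.integrable_lam j]
  simp

/-- Lower bound for the unconditional expected delay of every stopping time. -/
theorem le_lintegral_sub_phi (hM : N.BoundedLLR M) (hM0 : 0 ≤ M) (h : N.IsRealization P lam X)
    {S : Finset (Fin d)} (hS : S.Nonempty) {α : ℝ} (hα : 0 < α) {τ : Ω → ℕ∞}
    (hτ : τ ∈ h.ruleClass S α) :
    ENNReal.ofReal ((-Real.log α - h.overhead M S) / (N.priorRate S + N.totalInfo S)) ≤
      ∫⁻ ω, ((τ ω - h.phi S ω : ℕ∞) : ℝ≥0∞) ∂P := by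
  obtain ⟨hst, hfa⟩ := hτ
  have hD := hM.rate_pos hM0 hS
  set D := N.priorRate S + N.totalInfo S with hDdef
  set V := ∫⁻ ω, ((τ ω - h.phi S ω : ℕ∞) : ℝ≥0∞) ∂P with hV
  -- If the expected delay is infinite there is nothing to prove. Otherwise `τ` is almost surely
  -- finite and `T ≤ delta + Λ` is integrable, which supplies the dominating function for Wald's
  -- identity.
  by_cases hVt : V = ∞
  · rw [hVt]; exact le_top
  set E : ℝ := (extEdges N.graph).card * M with hE
  have hE0 : 0 ≤ E := by positivity
  have hτm := h.measurable_of_isStoppingTime hst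
  set T : Ω → ℕ := fun ω => (τ ω).toNat with hT
  have hTm : Measurable T := (measurable_of_countable ENat.toNat).comp hτm
  set φ : Ω → ℕ := fun ω => S.inf' hS fun j => lam j ω with hφ
  have hφm : Measurable φ := h.measurable_inf' hS
  have hmeasV : Measurable fun ω => ((τ ω - h.phi S ω : ℕ∞) : ℝ≥0∞) := by
    have : (fun ω => ((τ ω - h.phi S ω : ℕ∞) : ℝ≥0∞)) =
        (fun p : ℕ∞ × ℕ => ((p.1 - (p.2 : ℕ∞) : ℕ∞) : ℝ≥0∞)) ∘ fun ω => (τ ω, φ ω) := by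
      funext ω
      simp only [Function.comp, h.phi_eq hS, hφ]
    rw [this]
    exact (measurable_of_countable _).comp (hτm.prodMk hφm)
  have hfin : ∀ᵐ ω ∂P, τ ω ≠ ⊤ := by
    filter_upwards [ae_lt_top hmeasV hVt] with ω hω htop
    rw [htop, h.phi_eq hS] at hω
    simp at hω
  set delta : Ω → ℝ := fun ω => ((T ω - φ ω : ℕ) : ℝ) with hdelta
  have hdm : Measurable delta :=
    (measurable_of_countable fun p : ℕ × ℕ => ((p.1 - p.2 : ℕ) : ℝ)).comp (hTm.prodMk hφm)
  have hVd : V = ∫⁻ ω, ENNReal.ofReal (delta ω) ∂P := by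
    refine lintegral_congr_ae ?_
    filter_upwards [hfin] with ω hω
    obtain ⟨k, hk⟩ := ENat.ne_top_iff_exists.1 hω
    simp only [hdelta, hT, hφ, h.phi_eq hS, ← hk, ENat.toNat_natCast]
    rw [ENNReal.ofReal_natCast, ← ENat.natCast_sub, ENat.toENNReal_coe]
  have hdi : Integrable delta P := by
    refine ⟨hdm.aestronglyMeasurable, ?_⟩
    rw [hasFiniteIntegral_iff_ofReal (Eventually.of_forall fun ω => Nat.cast_nonneg _), ← hVd]
    exact lt_of_le_of_ne le_top hVt
  have hdV : ∫ ω, delta ω ∂P = V.toReal := by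
    rw [integral_eq_lintegral_of_nonneg_ae (Eventually.of_forall fun ω => Nat.cast_nonneg _)
      hdm.aestronglyMeasurable, ← hVd]
  set Λ : Ω → ℝ := fun ω => 1 + ∑ j, (lam j ω : ℝ) with hΛ
  have hΛi : Integrable Λ P := h.integrable_sum_lam
  have hTle : ∀ ω, (T ω : ℝ) ≤ delta ω + Λ ω := by
    intro ω
    obtain ⟨j, hj, hjm⟩ := S.exists_mem_eq_inf' hS fun j => lam j ω
    have h1 : φ ω ≤ ∑ j, lam j ω := by
      simp only [hφ]; rw [hjm]
      exact Finset.single_le_sum (f := fun j => lam j ω) (fun _ _ => Nat.zero_le _)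
        (Finset.mem_univ j)
    have h2 : T ω ≤ T ω - φ ω + (1 + ∑ j, lam j ω) := by omega
    have h3 : (T ω : ℝ) ≤ ((T ω - φ ω + (1 + ∑ j, lam j ω) : ℕ) : ℝ) := Nat.cast_le.2 h2
    refine h3.trans (le_of_eq ?_)
    simp only [hdelta, hΛ]
    push_cast
    ring
  set W : ℕ → Ω → ℝ := fun k ω =>
    h.score M (Distinguishing S) k ω - scoreComp N (Distinguishing S fun j => lam j ω) k with hW
  have hWb : ∀ k ω, |W k ω| ≤ 2 * E * k := by
    intro k ω
    refine (abs_sub _ _).trans ?_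
    have h1 := h.abs_score_le hM0 (Distinguishing S) k ω
    have h2 := hM.abs_scoreComp_le hM0 (Distinguishing S fun j => lam j ω) k
    calc _ ≤ (extEdges N.graph).card * (k * M) + (extEdges N.graph).card * (k * M) :=
          add_le_add h1 h2
      _ = _ := by rw [hE]; ring
  have hdist : ∀ (m : Fin d → ℕ) e t, Distinguishing S m e t → Changed m e t := fun m e t hh => hh.1
  have hWi := fun n => h.integrable_score_sub hM0 hst (Distinguishing S) n
  have hbi : Integrable (fun ω => 2 * E * (delta ω + Λ ω)) P := (hdi.add hΛi).const_mul _
  have hlim : ∀ᵐ ω ∂P, Tendsto (fun n => W (stoppedTime τ n ω) ω) atTop (𝓝 (W (T ω) ω)) := by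
    filter_upwards [hfin] with ω hω
    refine tendsto_const_nhds.congr' ?_
    filter_upwards [eventually_ge_atTop (T ω)] with n hn
    have : stoppedTime τ n ω = T ω := by
      rw [stoppedTime, min_eq_left]
      obtain ⟨k, hk⟩ := ENat.ne_top_iff_exists.1 hω
      simp only [hT, ← hk, ENat.toNat_natCast] at hn
      rw [← hk]
      exact_mod_cast hn
    rw [this]
  have hstopT : ∀ᵐ ω ∂P, ∀ n, stoppedTime τ n ω ≤ T ω := by
    filter_upwards [hfin] with ω hω n
    obtain ⟨k, hk⟩ := ENat.ne_top_iff_exists.1 hω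
    rw [← Nat.cast_le (α := ℕ∞), coe_stoppedTime]
    simp only [hT, ← hk, ENat.toNat_natCast]
    exact min_le_left _ _
  have hWTm : AEStronglyMeasurable (fun ω => W (T ω) ω) P :=
    aestronglyMeasurable_of_tendsto_ae atTop (fun n => (hWi n).aestronglyMeasurable) hlim
  have hWbound : ∀ k ω, k ≤ T ω → |W k ω| ≤ 2 * E * (delta ω + Λ ω) := by
    intro k ω hk
    refine (hWb k ω).trans (mul_le_mul_of_nonneg_left ?_ (by positivity))
    exact (Nat.cast_le.2 hk).trans (hTle ω)
  have hWTi : Integrable (fun ω => W (T ω) ω) P :=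
    hbi.mono' hWTm (Eventually.of_forall fun ω => hWbound _ ω le_rfl)
  -- Wald's identity passes from the truncations `τ ∧ n` to `τ` by dominated convergence.
  have hW0 : ∫ ω, W (T ω) ω ∂P = 0 := by
    have h1 := tendsto_integral_of_dominated_convergence (fun ω => 2 * E * (delta ω + Λ ω))
      (fun n => (hWi n).aestronglyMeasurable) hbi
      (fun n => by
        filter_upwards [hstopT] with ω hω
        exact hWbound _ ω (hω n)) hlim
    refine tendsto_nhds_unique h1 ?_
    simp_rw [integral_score_sub hM hM0 h hst hdist]
    exact tendsto_const_nhds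
  set C₁ : ℝ := N.priorRate S + E with hC₁
  -- The tangent line `1 + x ≤ exp x` at `x = -(q T + score_T) - log α`, with `q T + score_T`
  -- replaced by its upper bound `W + D delta + C₁ Λ`. It does the work of Jensen's inequality.
  set lower : Ω → ℝ := fun ω => 1 - Real.log α - W (T ω) ω - D * delta ω - C₁ * Λ ω with hlower
  have hlow : ∀ ω, lower ω ≤ Real.exp (-(N.priorRate S * T ω +
      h.score M (Distinguishing S) (T ω) ω)) / α := by
    intro ω
    have h1 := hM.abs_scoreComp_sub_le hM0 hS (fun j => lam j ω)
      (a := Distinguishing S fun j => lam j ω)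
      (fun e he t => distinguishing_iff he _ t) (fun e _ t hh => hh.2) (T ω)
    have h2 := (abs_le.1 h1).2
    have h3 : Real.exp (-(N.priorRate S * T ω + h.score M (Distinguishing S) (T ω) ω)) / α =
        Real.exp (-(N.priorRate S * T ω + h.score M (Distinguishing S) (T ω) ω) - Real.log α) := by
      rw [Real.exp_sub, Real.exp_log hα]
    rw [h3]
    refine le_trans ?_ (Real.add_one_le_exp _)
    simp only [hlower, hW, hdelta, hΛ, hC₁, hDdef, hφ]
    linarith
  have i1 : Integrable (fun ω => 1 - Real.log α - W (T ω) ω) P := (integrable_const _).sub hWTi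
  have i2 : Integrable (fun ω => 1 - Real.log α - W (T ω) ω - D * delta ω) P :=
    i1.sub (hdi.const_mul D)
  have hlowi : Integrable lower P := i2.sub (hΛi.const_mul C₁)
  have hI : ∫ ω, lower ω ∂P = 1 - Real.log α - D * V.toReal - h.overhead M S := by
    simp only [hlower]
    rw [integral_sub i2 (hΛi.const_mul C₁), integral_sub i1 (hdi.const_mul D),
      integral_sub (integrable_const _) hWTi, hW0, integral_const_mul, integral_const_mul, hdV,
      h.integral_sum_lam]
    simp [overhead, hC₁, hE]
  have hle1 : ∫⁻ ω, ENNReal.ofReal (lower ω) ∂P ≤ 1 := by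
    have hrestr : P.restrict {ω | τ ω ≠ ⊤} = P := Measure.restrict_eq_self_of_ae_mem hfin
    calc ∫⁻ ω, ENNReal.ofReal (lower ω) ∂P
        ≤ ∫⁻ ω, ENNReal.ofReal (Real.exp (-(N.priorRate S * T ω +
          h.score M (Distinguishing S) (T ω) ω))) * (ENNReal.ofReal α)⁻¹ ∂P := by
          refine lintegral_mono fun ω => ?_
          rw [← ENNReal.ofReal_inv_of_pos hα, ← ENNReal.ofReal_mul (Real.exp_nonneg _)]
          exact ENNReal.ofReal_le_ofReal (by rw [← div_eq_mul_inv]; exact hlow ω)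
      _ = (∫⁻ ω, ENNReal.ofReal (Real.exp (-(N.priorRate S * T ω +
          h.score M (Distinguishing S) (T ω) ω))) ∂P) * (ENNReal.ofReal α)⁻¹ :=
          lintegral_mul_const' _ _ (by simpa using hα)
      _ ≤ ENNReal.ofReal α * (ENNReal.ofReal α)⁻¹ := by
          gcongr
          refine le_trans ?_ hfa
          have := lintegral_exp_score_stopped_le hM hM0 h S hst
          rwa [hrestr] at this
      _ ≤ 1 := ENNReal.mul_inv_le_one _
  have hfinal := integral_le_toReal_lintegral_ofReal hlowi
  have h1 : (∫⁻ ω, ENNReal.ofReal (lower ω) ∂P).toReal ≤ 1 :=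
    ENNReal.toReal_le_of_le_ofReal zero_le_one (by simpa using hle1)
  rw [hI] at hfinal
  refine ENNReal.ofReal_le_of_le_toReal ?_
  rw [div_le_iff₀ hD]
  linarith

end IsRealization

end ChangePointNetwork

/-! ### The threshold rule: false alarms and a pathwise upper bound. -/

theorem Measurable.comp_countable {ι Ω β : Type*} [Countable ι] [MeasurableSpace ι]
    [MeasurableSingletonClass ι] [MeasurableSpace Ω] [MeasurableSpace β] {f : ι → Ω → β}
    (hf : ∀ i, Measurable (f i)) {g : Ω → ι} (hg : Measurable g) :
    Measurable fun ω => f (g ω) ω :=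
  (measurable_from_prod_countable_right (f := fun p : ι × Ω => f p.1 p.2) hf).comp
    (hg.prodMk measurable_id)

namespace ChangePointNetwork

variable {d : ℕ} {𝒳 : Type*} [MeasurableSpace 𝒳] {N : ChangePointNetwork d 𝒳} {M : ℝ}

variable (N) in
-- The power `m j - 1` is relaxed to `m j`, so that the negative log prior weight of the true
-- configuration has a majorant affine in `lam`, hence integrable.
theorem exp_neg_sum_le_priorWeight {m : Fin d → ℕ} (hm : ∀ j, 1 ≤ m j) :
    Real.exp (-∑ j, (-Real.log (1 - N.ρ j) * m j - Real.log (N.ρ j))) ≤ N.priorWeight m := by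
  rw [← Finset.sum_neg_distrib, Real.exp_sum]
  refine Finset.prod_le_prod (fun _ _ => Real.exp_nonneg _) fun j _ => ?_
  have h0 := N.ρ_pos j
  have h1 : 0 < 1 - N.ρ j := by linarith [N.ρ_lt_one j]
  have h2 : -(-Real.log (1 - N.ρ j) * m j - Real.log (N.ρ j)) =
      (m j : ℝ) * Real.log (1 - N.ρ j) + Real.log (N.ρ j) := by ring
  rw [h2, Real.exp_add, Real.exp_log h0, Real.exp_nat_mul, Real.exp_log h1, geomWeight,
    if_neg (by have := hm j; omega)]
  exact mul_le_mul_of_nonneg_right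
    (pow_le_pow_of_le_one h1.le (by linarith) (Nat.sub_le _ _)) h0.le

namespace IsRealization

variable {Ω : Type*} [mΩ : MeasurableSpace Ω] {P : Measure Ω}
  {lam : Fin d → Ω → ℕ} {X : Finset (Fin d) → ℕ → Ω → 𝒳}

theorem thresholdRule_le_iff (h : N.IsRealization P lam X) (S : Finset (Fin d)) (α : ℝ) (ω : Ω)
    (n : ℕ) : h.thresholdRule S α ω ≤ n ↔ ∃ k, 1 ≤ k ∧ k ≤ n ∧ 1 - α ≤ h.posterior S k ω := by
  have h1 : h.thresholdRule S α ω ≤ n ↔ h.thresholdRule S α ω < ((n + 1 : ℕ) : ℕ∞) := by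
    rw [Nat.cast_add, Nat.cast_one, ENat.lt_add_one_iff (ENat.natCast_ne_top n)]
  rw [h1, thresholdRule]
  simp only [iInf_lt_iff, Nat.cast_lt, Nat.lt_succ_iff]
  constructor
  · rintro ⟨k, ⟨hk1, hk2⟩, hk⟩; exact ⟨k, hk1, hk, hk2⟩
  · rintro ⟨k, hk1, hk, hk2⟩; exact ⟨k, ⟨hk1, hk2⟩, hk⟩

theorem one_le_thresholdRule (h : N.IsRealization P lam X) (S : Finset (Fin d)) (α : ℝ) (ω : Ω) :
    1 ≤ h.thresholdRule S α ω :=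
  le_iInf₂ fun n hn => by exact_mod_cast hn.1

theorem isStoppingTime_thresholdRule (h : N.IsRealization P lam X) (S : Finset (Fin d)) (α : ℝ) :
    IsStoppingTime h.obsFiltration (h.thresholdRule S α) := by
  intro n
  have : {ω | h.thresholdRule S α ω ≤ (n : ℕ∞)} =
      ⋃ k ∈ Finset.Icc 1 n, {ω | 1 - α ≤ h.posterior S k ω} := by
    ext ω
    rw [Set.mem_ofPred_eq, h.thresholdRule_le_iff]
    simp [and_assoc]
  change MeasurableSet[h.obsFiltration n] {ω | h.thresholdRule S α ω ≤ (n : ℕ∞)}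
  rw [this]
  refine Finset.measurableSet_biUnion _ fun k hk => ?_
  refine h.obsFiltration.mono (Finset.mem_Icc.1 hk).2 _ ?_
  exact stronglyMeasurable_condExp.measurable measurableSet_Ici

theorem le_posterior_of_thresholdRule_eq (h : N.IsRealization P lam X) (S : Finset (Fin d)) (α : ℝ)
    {ω : Ω} {n : ℕ} (hω : h.thresholdRule S α ω = n) : 1 - α ≤ h.posterior S n ω := by
  obtain ⟨k, hk1, hk2, hk3⟩ := (h.thresholdRule_le_iff S α ω n).1 hω.le
  have : h.thresholdRule S α ω ≤ k := (h.thresholdRule_le_iff S α ω k).2 ⟨k, hk1, le_rfl, hk3⟩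
  rw [hω] at this
  have hnk : n ≤ k := by exact_mod_cast this
  rwa [le_antisymm hk2 hnk] at hk3

theorem measurableSet_lt_phi (h : N.IsRealization P lam X) (S : Finset (Fin d)) (n : ℕ) :
    MeasurableSet {ω | (n : ℕ∞) < h.phi S ω} := by
  simp_rw [h.coe_lt_phi_iff]
  exact h.measurable_lamVec (MeasurableSet.of_discrete (s := {m | ∀ j ∈ S, n < m j}))

/-- On `{τ = n}` the posterior probability of no change is at most `α`, and this event belongs to
`obsFiltration n`. Integrating and summing over finite `n` suffices, since a false alarm forces `τ`
to be finite. -/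
theorem thresholdRule_mem_ruleClass [IsProbabilityMeasure P] (h : N.IsRealization P lam X)
    (S : Finset (Fin d)) {α : ℝ} (hα : 0 < α) : h.thresholdRule S α ∈ h.ruleClass S α := by
  have hst := h.isStoppingTime_thresholdRule S α
  refine ⟨hst, ?_⟩
  set τ := h.thresholdRule S α with hτ
  have hτn : ∀ n : ℕ, MeasurableSet[h.obsFiltration n] {ω | τ ω = n} := hst.measurableSet_eq
  have hτn' := fun n => h.obsFiltration.le n _ (hτn n)
  have hdisj : Pairwise (Function.onFun Disjoint fun n : ℕ => {ω | τ ω = n}) := by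
    intro n n' hne
    refine Set.disjoint_left.2 fun ω (h1 : τ ω = n) (h2 : τ ω = n') => hne ?_
    exact_mod_cast h1.symm.trans h2
  have hsub : {ω | τ ω < h.phi S ω} ⊆ ⋃ n : ℕ, {ω | τ ω = n} ∩ {ω | (n : ℕ∞) < h.phi S ω} := by
    intro ω (hω : τ ω < h.phi S ω)
    obtain ⟨n, hn⟩ := ENat.ne_top_iff_exists.1 (ne_top_of_lt hω)
    refine Set.mem_iUnion.2 ⟨n, hn.symm, ?_⟩
    change (n : ℕ∞) < h.phi S ω
    rwa [hn]
  have hbound : ∀ n : ℕ, P ({ω | τ ω = n} ∩ {ω | (n : ℕ∞) < h.phi S ω}) ≤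
      ENNReal.ofReal α * P {ω | τ ω = n} := by
    intro n
    have hc : {ω | (n : ℕ∞) < h.phi S ω} = {ω | h.phi S ω ≤ n}ᶜ := by
      ext ω; simp
    have hsm : MeasurableSet {ω | h.phi S ω ≤ n} := by
      have := (h.measurableSet_lt_phi S n).compl
      rwa [hc, compl_compl] at this
    have h1 : ∫ ω in {ω | τ ω = n}, h.posterior S n ω ∂P =
        P.real ({ω | τ ω = n} ∩ {ω | h.phi S ω ≤ n}) := by
      rw [posterior, setIntegral_condExp (h.obsFiltration.le n)
        ((integrable_const 1).indicator hsm) (hτn n), setIntegral_indicator hsm]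
      simp
    have h2 : (1 - α) * P.real {ω | τ ω = n} ≤ ∫ ω in {ω | τ ω = n}, h.posterior S n ω ∂P := by
      calc (1 - α) * P.real {ω | τ ω = n} = ∫ ω in {ω | τ ω = n}, (1 - α) ∂P := by
            rw [setIntegral_const, smul_eq_mul, mul_comm]
        _ ≤ _ := setIntegral_mono_on (integrable_const _).integrableOn
          integrable_condExp.integrableOn (hτn' n)
          fun ω hω => h.le_posterior_of_thresholdRule_eq S α hω
    have h3 := measureReal_inter_add_sdiff (μ := P) (s := {ω | τ ω = n}) hsm
    rw [Set.sdiff_eq, ← hc] at h3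
    have h4 : P.real ({ω | τ ω = n} ∩ {ω | (n : ℕ∞) < h.phi S ω}) ≤ α * P.real {ω | τ ω = n} := by
      linarith
    rw [← ofReal_measureReal, ← ofReal_measureReal, ← ENNReal.ofReal_mul hα.le]
    exact ENNReal.ofReal_le_ofReal h4
  calc P {ω | τ ω < h.phi S ω} ≤ ∑' n : ℕ, P ({ω | τ ω = n} ∩ {ω | (n : ℕ∞) < h.phi S ω}) :=
        (measure_mono hsub).trans (measure_iUnion_le _)
    _ ≤ ∑' n : ℕ, ENNReal.ofReal α * P {ω | τ ω = n} := ENNReal.tsum_le_tsum hbound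
    _ = ENNReal.ofReal α * P (⋃ n : ℕ, {ω | τ ω = n}) := by
        rw [ENNReal.tsum_mul_left, measure_iUnion hdisj hτn']
    _ ≤ ENNReal.ofReal α := mul_le_of_le_one_right' prob_le_one

/-- The log-likelihood ratio, on the nodes and edges that are not inside `S`, of the configuration
`m'` with the change points in `S` removed against the configuration `m`. -/
noncomputable def logOut (_h : N.IsRealization P lam X) (M : ℝ) (S : Finset (Fin d))
    (m' m : Fin d → ℕ) (n : ℕ) (ω : Ω) : ℝ :=
  ∑ e ∈ extEdges N.graph, ∑ t ∈ Finset.Icc 1 n, if e ⊆ S then 0 else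
    (if Changed m' (e \ S) t then N.llr M e (X e t ω) else 0) -
      if Changed m e t then N.llr M e (X e t ω) else 0

theorem measurable_logOut (h : N.IsRealization P lam X) (S : Finset (Fin d)) (m' m : Fin d → ℕ)
    (n : ℕ) : Measurable (h.logOut M S m' m n) := by
  refine Finset.measurable_sum _ fun e he => Finset.measurable_sum _ fun t ht => ?_
  have := (measurable_llr (M := M) he).comp (h.measurable_obs e he _ (Finset.mem_Icc.1 ht).1)
  simp only [Function.comp_def] at this
  split_ifs <;> fun_prop

/-- The delay removes every change on an edge inside `S`, which gives `-score`. On the remaining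
edges `m'` acts only through its nodes outside `S`, and those terms no longer involve the shift. -/
theorem logLik_shift_sub (h : N.IsRealization P lam X) {m' : Fin d → ℕ} (hm' : ∀ j, 1 ≤ m' j)
    (S : Finset (Fin d)) (n : ℕ) (ω : Ω) :
    h.logLik M (shift S n m') n ω - h.logLik M (fun j => lam j ω) n ω =
      h.logOut M S m' (fun j => lam j ω) n ω - h.score M (ChangedInside S) n ω := by
  unfold logLik logOut score
  rw [← Finset.sum_sub_distrib, ← Finset.sum_sub_distrib]
  refine Finset.sum_congr rfl fun e _ => ?_
  rw [← Finset.sum_sub_distrib, ← Finset.sum_sub_distrib]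
  refine Finset.sum_congr rfl fun t ht => ?_
  have h1 := changed_shift_iff hm' S e (Finset.mem_Icc.1 ht).2
  simp only [h1]
  by_cases heS : e ⊆ S
  · have h2 : ¬ Changed m' (e \ S) t := by simp [Finset.sdiff_eq_empty_iff_subset.2 heS]
    rw [if_neg h2, if_pos heS]
    by_cases c : Changed (fun j => lam j ω) e t
    · rw [if_pos c, if_pos ⟨heS, c⟩]
    · rw [if_neg c, if_neg fun hh : ChangedInside S _ e t => c hh.2]
  · rw [if_neg heS, if_neg fun hh : ChangedInside S _ e t => heS hh.1, sub_zero]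

/-- One more time step changes each term by at most `2M` when both changes are active with opposite
signs formally, but these cancel; the actual cost is `M` per edge. It is needed because the
likelihood comparison holds one step before the stopping time at which the mean is controlled. -/
theorem logOut_le_succ (hM0 : 0 ≤ M) (h : N.IsRealization P lam X) (S : Finset (Fin d))
    (m' m : Fin d → ℕ) (n : ℕ) (ω : Ω) :
    h.logOut M S m' m n ω ≤ h.logOut M S m' m (n + 1) ω + (extEdges N.graph).card * M := by
  unfold logOut
  rw [← nsmul_eq_mul, ← Finset.sum_const, ← Finset.sum_add_distrib]
  refine Finset.sum_le_sum fun e _ => ?_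
  rw [Finset.sum_Icc_succ_top (by omega), add_assoc]
  refine le_add_of_nonneg_right ?_
  have := abs_le.1 (abs_llr_le (N := N) hM0 e (X e (n + 1) ω))
  split_ifs <;> linarith

theorem score_succ_le (hM0 : 0 ≤ M) (h : N.IsRealization P lam X)
    (a : (Fin d → ℕ) → Finset (Fin d) → ℕ → Prop) (n : ℕ) (ω : Ω) :
    h.score M a (n + 1) ω ≤ h.score M a n ω + (extEdges N.graph).card * M := by
  unfold score
  rw [← nsmul_eq_mul, ← Finset.sum_const, ← Finset.sum_add_distrib]
  refine Finset.sum_le_sum fun e _ => ?_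
  rw [Finset.sum_Icc_succ_top (by omega)]
  have := abs_le.1 (abs_llr_le (N := N) hM0 e (X e (n + 1) ω))
  split_ifs <;> linarith

/-- Mixture over the prior of the likelihood ratios outside `S` against the true configuration. -/
noncomputable def mixOut (h : N.IsRealization P lam X) (M : ℝ) (S : Finset (Fin d))
    (m : Fin d → ℕ) (n : ℕ) (ω : Ω) : ℝ≥0∞ :=
  ∑' m', ENNReal.ofReal (N.priorWeight m') * ENNReal.ofReal (Real.exp (h.logOut M S m' m n ω))

theorem measurable_mixOut (h : N.IsRealization P lam X) (S : Finset (Fin d)) (m : Fin d → ℕ)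
    (n : ℕ) : Measurable (h.mixOut M S m n) := by
  refine Measurable.tsum fun m' => ?_
  have := h.measurable_logOut (M := M) S m' m n
  fun_prop

theorem mixOut_le_succ (hM0 : 0 ≤ M) (h : N.IsRealization P lam X) (S : Finset (Fin d))
    (m : Fin d → ℕ) (n : ℕ) (ω : Ω) :
    h.mixOut M S m n ω ≤
      ENNReal.ofReal (Real.exp ((extEdges N.graph).card * M)) * h.mixOut M S m (n + 1) ω := by
  unfold mixOut
  rw [← ENNReal.tsum_mul_left]
  refine ENNReal.tsum_le_tsum fun m' => ?_
  rw [mul_left_comm]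
  gcongr
  rw [← ENNReal.ofReal_mul (Real.exp_nonneg _), ← Real.exp_add]
  refine ENNReal.ofReal_le_ofReal (Real.exp_le_exp.2 ?_)
  rw [add_comm]
  exact h.logOut_le_succ hM0 S m' m n ω

theorem measurable_stoppedTime (h : N.IsRealization P lam X) {τ : Ω → ℕ∞}
    (hτ : IsStoppingTime h.obsFiltration τ) (n : ℕ) : Measurable (stoppedTime τ n) :=
  (measurable_of_countable fun k : ℕ∞ => (min k n).toNat).comp (h.measurable_of_isStoppingTime hτ)

/-- Memorylessness writes the configurations unchanged on `S` as delayed ones. Relative to the true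
likelihood each delayed likelihood splits into a part inside `S`, common to all configurations, and
a part outside, which is averaged in `mixOut`. -/
theorem mixLik_not_changed_eq (h : N.IsRealization P lam X) (S : Finset (Fin d)) (n : ℕ) (ω : Ω) :
    h.mixLik M (fun m => ¬ Changed m S n) n ω =
      ENNReal.ofReal (Real.exp (h.logLik M (fun j => lam j ω) n ω - N.priorRate S * n -
        h.score M (ChangedInside S) n ω)) * h.mixOut M S (fun j => lam j ω) n ω := by
  classical
  have h1 := tsum_priorWeight_shift (N := N) S n fun m =>
    ENNReal.ofReal (Real.exp (h.logLik M m n ω))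
  have h2 : ∀ m : Fin d → ℕ, (∀ j ∈ S, n < m j) ↔ ¬ Changed m S n := by
    intro m; push Not; rfl
  simp only [h2] at h1
  have h5 : h.mixLik M (fun m => ¬ Changed m S n) n ω =
      ENNReal.ofReal (Real.exp (-(N.priorRate S * n))) * ∑' m, ENNReal.ofReal (N.priorWeight m) *
        ENNReal.ofReal (Real.exp (h.logLik M (shift S n m) n ω)) := by
    rw [← h1]
    unfold mixLik
    refine tsum_congr fun m => ?_
    by_cases hc : Changed m S n
    · rw [if_neg (not_not.2 hc), if_neg (not_not.2 hc)]
    · rw [if_pos hc, if_pos hc]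
  rw [h5]
  unfold mixOut
  rw [← ENNReal.tsum_mul_left, ← ENNReal.tsum_mul_left]
  refine tsum_congr fun m' => ?_
  by_cases hm0 : N.priorWeight m' = 0
  · simp [hm0]
  have hm' := N.one_le_of_priorWeight_ne_zero hm0
  have h3 := h.logLik_shift_sub (M := M) hm' S n ω
  have h4 : h.logLik M (shift S n m') n ω = h.logLik M (fun j => lam j ω) n ω +
    h.logOut M S m' (fun j => lam j ω) n ω - h.score M (ChangedInside S) n ω := by linarith
  rw [h4, mul_left_comm (ENNReal.ofReal (Real.exp _)) (ENNReal.ofReal (N.priorWeight m')),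
    mul_left_comm (ENNReal.ofReal (Real.exp _)) (ENNReal.ofReal (N.priorWeight m')),
    ← ENNReal.ofReal_mul (Real.exp_nonneg _),
    ← ENNReal.ofReal_mul (Real.exp_nonneg _), ← Real.exp_add, ← Real.exp_add]
  congr 3
  ring

variable [IsProbabilityMeasure P]

/-- For fixed `m` and `m'` the exponential of `logOut` is a product of likelihood ratios of mean one
under the law given `m`, so optional stopping applies before averaging over both priors. -/
theorem lintegral_mixOut_le (hM : N.BoundedLLR M) (hM0 : 0 ≤ M) (h : N.IsRealization P lam X)
    (S : Finset (Fin d)) {τ : Ω → ℕ∞} (hτ : IsStoppingTime h.obsFiltration τ) (n : ℕ) :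
    ∫⁻ ω, h.mixOut M S (fun j => lam j ω) (stoppedTime τ n ω) ω ∂P ≤ 1 := by
  have hK := h.measurable_stoppedTime hτ n
  rw [h.lintegral_eq_tsum fun m ω => h.mixOut M S m (stoppedTime τ n ω) ω]
  rw [← h.tsum_priorWeight]
  refine ENNReal.tsum_le_tsum fun m => ?_
  by_cases hm0 : N.priorWeight m = 0
  · simp [hm0]
  have hm := N.one_le_of_priorWeight_ne_zero hm0
  refine mul_le_of_le_one_right' ?_
  unfold mixOut
  rw [lintegral_tsum]
  · rw [← h.tsum_priorWeight]
    refine ENNReal.tsum_le_tsum fun m' => ?_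
    rw [lintegral_const_mul' _ _ ENNReal.ofReal_ne_top]
    by_cases hm0' : N.priorWeight m' = 0
    · simp [hm0']
    have hm' := N.one_le_of_priorWeight_ne_zero hm0'
    refine mul_le_of_le_one_right' (le_of_eq ?_)
    set u : Finset (Fin d) → ℕ → 𝒳 → ℝ≥0∞ := fun e t x =>
      if e ∈ extEdges N.graph then ENNReal.ofReal (Real.exp (if e ⊆ S then 0 else
        (if Changed m' (e \ S) t then N.llr M e x else 0) -
        if Changed m e t then N.llr M e x else 0)) else 1 with hu
    have hum : ∀ e t, Measurable (u e t) := by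
      intro e t
      by_cases he : e ∈ extEdges N.graph
      · have := measurable_llr (M := M) he
        simp only [hu, if_pos he]
        split_ifs <;> fun_prop
      · simp only [hu, if_neg he]; exact measurable_const
    rw [← h.lintegral_prod_stoppedTime hm hum ?_ hτ n]
    · refine lintegral_congr fun ω => ?_
      rw [logOut, Real.exp_sum, ENNReal.ofReal_prod_of_nonneg fun _ _ => Real.exp_nonneg _]
      refine Finset.prod_congr rfl fun e he => ?_
      rw [Real.exp_sum, ENNReal.ofReal_prod_of_nonneg fun _ _ => Real.exp_nonneg _]
      refine Finset.prod_congr rfl fun t _ => ?_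
      simp only [hu, if_pos he]
    · intro e he t _
      have hprob := isProbabilityMeasure_obsLaw (N := N) he
      simp only [hu, if_pos he]
      by_cases heS : e ⊆ S
      · simp [heS]
      -- At time `t` the configuration `shift S t m'` has the change status dictated by `m'` on `e \
      -- S`, so the factor is a genuine likelihood ratio.
      · have key := hM.withDensity_exp hM0 he m (shift S t m') t
        have := congrArg (fun ν => ν Set.univ) key
        simp only [withDensity_apply _ MeasurableSet.univ, Measure.restrict_univ, measure_univ,
          changed_shift_iff hm' S e le_rfl] at this
        simpa only [heS, if_false] using this
  · intro m'
    refine Measurable.aemeasurable (Measurable.const_mul ?_ _)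
    exact Measurable.comp_countable (f := fun k ω => ENNReal.ofReal
      (Real.exp (h.logOut M S m' m k ω)))
      (fun k => ENNReal.measurable_ofReal.comp (Real.measurable_exp.comp
        (h.measurable_logOut S m' m k))) hK

theorem ofReal_mul_mixLik_le (hM : N.BoundedLLR M) (hM0 : 0 ≤ M) (h : N.IsRealization P lam X)
    (S : Finset (Fin d)) {α : ℝ} (hα : 0 < α) (hα1 : α < 1) :
    ∀ᵐ ω ∂P, ∀ n : ℕ, (n : ℕ∞) < h.thresholdRule S α ω →
      ENNReal.ofReal α * h.mixLik M (fun _ => True) n ω ≤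
        h.mixLik M (fun m => ¬ Changed m S n) n ω := by
  have hall : ∀ᵐ ω ∂P, ∀ n, h.posterior S n ω = (h.mixLik M (fun m => Changed m S n) n ω /
      h.mixLik M (fun _ => True) n ω).toReal :=
    ae_all_iff.2 fun n => posterior_ae_eq hM hM0 h S n
  filter_upwards [hall] with ω hω n hn
  have hsum := h.mixLik_add_not (M := M) (fun m => Changed m S n) n ω
  -- The rule does not inspect time `0`, so that case is separate: every change point is at least
  -- `1`, and the whole mixture is unchanged.
  rcases Nat.eq_zero_or_pos n with rfl | hpos
  · have h0 : h.mixLik M (fun m => Changed m S 0) 0 ω = 0 := by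
      unfold mixLik
      refine ENNReal.tsum_eq_zero.2 fun m => ?_
      split_ifs with hc
      · obtain ⟨j, _, hj⟩ := hc
        have : N.priorWeight m = 0 := by
          by_contra hne
          have := N.one_le_of_priorWeight_ne_zero hne j
          omega
        simp [this]
      · rfl
    rw [h0, zero_add] at hsum
    rw [hsum]
    exact mul_le_of_le_one_left' (by simpa using hα1.le)
  · set c := h.mixLik M (fun m => Changed m S n) n ω with hc
    set b := h.mixLik M (fun _ => True) n ω with hb
    set a := h.mixLik M (fun m => ¬ Changed m S n) n ω with ha
    have hbt : b ≠ ∞ := h.mixLik_ne_top hM0 _ _ _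
    have hct : c ≠ ∞ := h.mixLik_ne_top hM0 _ _ _
    have hat : a ≠ ∞ := h.mixLik_ne_top hM0 _ _ _
    have hb0 : b ≠ 0 := h.mixLik_true_ne_zero _ _
    have hpost : h.posterior S n ω < 1 - α := by
      by_contra hcon
      exact absurd ((h.thresholdRule_le_iff S α ω n).2 ⟨n, hpos, le_rfl, not_lt.1 hcon⟩)
        (not_le.2 hn)
    rw [hω n, ENNReal.toReal_div] at hpost
    have hbpos : 0 < b.toReal := ENNReal.toReal_pos hb0 hbt
    rw [div_lt_iff₀ hbpos] at hpost
    have hs : c.toReal + a.toReal = b.toReal := by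
      rw [← ENNReal.toReal_add hct hat, hsum]
    rw [← ENNReal.ofReal_toReal hbt, ← ENNReal.ofReal_toReal hat, ← ENNReal.ofReal_mul hα.le]
    refine ENNReal.ofReal_le_ofReal ?_
    linarith

/-- Pathwise upper bound for the log-likelihood at the (truncated) threshold rule. -/
theorem priorRate_mul_add_score_le (hM : N.BoundedLLR M) (hM0 : 0 ≤ M)
    (h : N.IsRealization P lam X) (S : Finset (Fin d)) {α : ℝ} (hα : 0 < α) (hα1 : α < 1) :
    ∀ᵐ ω ∂P, ∀ k : ℕ, (k : ℕ∞) < h.thresholdRule S α ω →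
      h.mixOut M S (fun j => lam j ω) (k + 1) ω ≠ ∞ →
      N.priorRate S * k + h.score M (ChangedInside S) (k + 1) ω ≤
        -Real.log α + ∑ j, (-Real.log (1 - N.ρ j) * lam j ω - Real.log (N.ρ j)) +
        2 * ((extEdges N.graph).card * M) +
        (h.mixOut M S (fun j => lam j ω) (k + 1) ω).toReal := by
  filter_upwards [ofReal_mul_mixLik_le hM hM0 h S hα hα1, h.ae_one_le_lam] with ω hω hlam k hk hY
  set E : ℝ := (extEdges N.graph).card * M with hE
  set Y := h.mixOut M S (fun j => lam j ω) (k + 1) ω with hYdef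
  set H : ℝ := ∑ j, (-Real.log (1 - N.ρ j) * lam j ω - Real.log (N.ρ j)) with hH
  set L := h.logLik M (fun j => lam j ω) k ω with hL
  set s := h.score M (ChangedInside S) k ω with hs
  -- The total mixture is bounded below by the term of the true configuration; the true
  -- log-likelihood `L` then cancels.
  have h1 : ENNReal.ofReal (Real.exp (Real.log α - H + L)) ≤
      ENNReal.ofReal (Real.exp (L - N.priorRate S * k - s + E)) * Y := by
    calc ENNReal.ofReal (Real.exp (Real.log α - H + L))
        = ENNReal.ofReal α * (ENNReal.ofReal (Real.exp (-H)) * ENNReal.ofReal (Real.exp L)) := by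
          rw [← ENNReal.ofReal_mul (Real.exp_nonneg _), ← ENNReal.ofReal_mul hα.le, Real.exp_add,
            sub_eq_add_neg, Real.exp_add, Real.exp_log hα, mul_assoc]
      _ ≤ ENNReal.ofReal α * h.mixLik M (fun _ => True) k ω := by
          gcongr
          refine le_trans ?_ (h.le_mixLik (p := fun _ => True) (m := fun j => lam j ω) trivial k ω)
          gcongr
          exact N.exp_neg_sum_le_priorWeight hlam
      _ ≤ _ := hω k hk
      _ = ENNReal.ofReal (Real.exp (L - N.priorRate S * k - s)) *
          h.mixOut M S (fun j => lam j ω) k ω := h.mixLik_not_changed_eq S k ω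
      _ ≤ ENNReal.ofReal (Real.exp (L - N.priorRate S * k - s)) *
          (ENNReal.ofReal (Real.exp E) * Y) := by
          gcongr
          exact h.mixOut_le_succ hM0 S _ k ω
      _ = _ := by
          rw [← mul_assoc, ← ENNReal.ofReal_mul (Real.exp_nonneg _), ← Real.exp_add]
  rw [← ENNReal.ofReal_toReal hY, ← ENNReal.ofReal_mul (Real.exp_nonneg _),
    ENNReal.ofReal_le_ofReal_iff (by positivity)] at h1
  have hy0 : 0 < Y.toReal := by
    by_contra hcon
    have := le_antisymm (not_lt.1 hcon) ENNReal.toReal_nonneg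
    rw [this, mul_zero] at h1
    exact absurd h1 (not_le.2 (Real.exp_pos _))
  have h2 : Real.log α - H + L ≤ L - N.priorRate S * k - s + E + Real.log Y.toReal := by
    rw [← Real.exp_le_exp, Real.exp_add _ (Real.log _), Real.exp_log hy0]
    exact h1
  -- Replaces `log Y` by `Y`, whose expectation is at most one at the stopped time.
  have h3 := Real.log_le_sub_one_of_pos hy0
  have h4 := h.score_succ_le hM0 (ChangedInside S) k ω
  linarith

end IsRealization

end ChangePointNetwork

/-! ### Asymptotics, the expected delay of the threshold rule, and the conclusion. -/

theorem ENNReal.tendsto_div_ofReal_abs_log {F : ℝ → ℝ≥0∞} {C C' D : ℝ} (hD : 0 < D)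
    (hlow : ∀ α, 0 < α → α < 1 → ENNReal.ofReal ((-Real.log α - C) / D) ≤ F α)
    (hupp : ∀ α, 0 < α → α < 1 →
      F α ≤ ENNReal.ofReal ((-Real.log α + C') / D) / ENNReal.ofReal (1 - α)) :
    Tendsto (fun α : ℝ => F α / ENNReal.ofReal (|Real.log α| / D)) (𝓝[>] 0) (𝓝 1) := by
  have hlog : Tendsto (fun α : ℝ => -Real.log α) (𝓝[>] 0) atTop :=
    tendsto_neg_atBot_atTop.comp Real.tendsto_log_nhdsGT_zero
  have hinv : Tendsto (fun α : ℝ => (-Real.log α)⁻¹) (𝓝[>] 0) (𝓝 0) :=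
    tendsto_inv_atTop_zero.comp hlog
  have hev : ∀ᶠ α : ℝ in 𝓝[>] 0, 0 < α ∧ α < 1 := by
    filter_upwards [Ioo_mem_nhdsGT (zero_lt_one (α := ℝ))] with α hα
    exact hα
  have hone : Tendsto (fun α : ℝ => 1 - α) (𝓝[>] 0) (𝓝 1) := by
    have : Tendsto (fun α : ℝ => 1 - α) (𝓝 0) (𝓝 (1 - 0)) := tendsto_const_nhds.sub tendsto_id
    rw [sub_zero] at this
    exact this.mono_left nhdsWithin_le_nhds
  have hl : Tendsto (fun α : ℝ => ENNReal.ofReal (1 - C * (-Real.log α)⁻¹)) (𝓝[>] 0) (𝓝 1) := by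
    rw [← ENNReal.ofReal_one]
    refine ENNReal.tendsto_ofReal ?_
    simpa using tendsto_const_nhds.sub (hinv.const_mul C)
  have hu : Tendsto (fun α : ℝ => ENNReal.ofReal ((1 + C' * (-Real.log α)⁻¹) / (1 - α)))
      (𝓝[>] 0) (𝓝 1) := by
    rw [← ENNReal.ofReal_one]
    refine ENNReal.tendsto_ofReal ?_
    have h1 : Tendsto (fun α : ℝ => 1 + C' * (-Real.log α)⁻¹) (𝓝[>] 0) (𝓝 1) := by
      simpa using tendsto_const_nhds.add (hinv.const_mul C')
    have h2 := h1.div hone one_ne_zero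
    rwa [div_one] at h2
  refine tendsto_of_tendsto_of_tendsto_of_le_of_le' hl hu ?_ ?_
  · filter_upwards [hev] with α ⟨h0, h1⟩
    have hL : 0 < -Real.log α := by linarith [Real.log_neg h0 h1]
    refine le_trans (le_of_eq ?_) (ENNReal.div_le_div_right (hlow α h0 h1) _)
    rw [abs_of_neg (Real.log_neg h0 h1), ← ENNReal.ofReal_div_of_pos (div_pos hL hD)]
    congr 1
    have := hL.ne'
    have := hD.ne'
    generalize -Real.log α = L at *
    field_simp
  · filter_upwards [hev] with α ⟨h0, h1⟩
    have hL : 0 < -Real.log α := by linarith [Real.log_neg h0 h1]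
    have hα : 0 < 1 - α := by linarith
    refine (ENNReal.div_le_div_right (hupp α h0 h1) _).trans (le_of_eq ?_)
    rw [abs_of_neg (Real.log_neg h0 h1), ← ENNReal.ofReal_div_of_pos hα,
      ← ENNReal.ofReal_div_of_pos (div_pos hL hD)]
    congr 1
    have := hL.ne'
    have := hD.ne'
    have := hα.ne'
    generalize -Real.log α = L at *
    field_simp

namespace ChangePointNetwork

variable {d : ℕ} {𝒳 : Type*} [MeasurableSpace 𝒳] {N : ChangePointNetwork d 𝒳} {M : ℝ}

theorem BoundedLLR.mono (hM : N.BoundedLLR M) {M' : ℝ} (hMM' : M ≤ M') : N.BoundedLLR M' := by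
  intro e he
  filter_upwards [hM e he] with x hx
  exact hx.imp_right fun ⟨h1, h2, h3⟩ => ⟨h1, h2, h3.trans hMM'⟩

namespace IsRealization

variable {Ω : Type*} [mΩ : MeasurableSpace Ω] {P : Measure Ω}
  {lam : Fin d → Ω → ℕ} {X : Finset (Fin d) → ℕ → Ω → 𝒳}

/-- The constant in the upper bound for the expected delay of the threshold rule. -/
noncomputable def overheadUpper (h : N.IsRealization P lam X) (M : ℝ) (S : Finset (Fin d)) : ℝ :=
  h.overhead M S + N.priorRate S + 2 * ((extEdges N.graph).card * M) + 1 +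
    ∫ ω, ∑ j, (-Real.log (1 - N.ρ j) * lam j ω - Real.log (N.ρ j)) ∂P

theorem measurable_phi (h : N.IsRealization P lam X) (S : Finset (Fin d)) :
    Measurable (h.phi S) :=
  (measurable_of_countable fun m : Fin d → ℕ => minOver S m).comp h.measurable_lamVec

theorem measurable_sub_phi (h : N.IsRealization P lam X) (S : Finset (Fin d)) {τ : Ω → ℕ∞}
    (hτ : Measurable τ) : Measurable fun ω => ((τ ω - h.phi S ω : ℕ∞) : ℝ≥0∞) :=
  (measurable_of_countable fun p : ℕ∞ × ℕ∞ => ((p.1 - p.2 : ℕ∞) : ℝ≥0∞)).comp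
    (hτ.prodMk (h.measurable_phi S))

/-- For nonempty `S` the value `λ_S` is finite, so `τ + 1 ≤ λ_S` forces `τ < λ_S`. -/
theorem add_one_mem_ruleClassLE (h : N.IsRealization P lam X) {S : Finset (Fin d)}
    (hS : S.Nonempty) {α : ℝ}
    {τ : Ω → ℕ∞} (hτ : τ ∈ h.ruleClass S α) : (fun ω => τ ω + 1) ∈ h.ruleClassLE S α := by
  obtain ⟨hst, hfa⟩ := hτ
  refine ⟨fun n => ?_, (measure_mono fun ω hω => ?_).trans hfa⟩
  · rcases n with _ | n
    · have : {ω | τ ω + 1 ≤ ((0 : ℕ) : ℕ∞)} = ∅ := by ext ω; simp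
      change MeasurableSet[h.obsFiltration 0] {ω | τ ω + 1 ≤ ((0 : ℕ) : ℕ∞)}
      rw [this]
      exact @MeasurableSet.empty _ (h.obsFiltration 0)
    · have : {ω | τ ω + 1 ≤ ((n + 1 : ℕ) : ℕ∞)} = {ω | τ ω ≤ (n : ℕ∞)} := by
        ext ω
        simp only [Set.mem_ofPred_eq, Nat.cast_add, Nat.cast_one]
        exact ENat.add_le_add_iff_right ENat.one_ne_top
      change MeasurableSet[h.obsFiltration (n + 1)] {ω | τ ω + 1 ≤ ((n + 1 : ℕ) : ℕ∞)}
      rw [this]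
      exact h.obsFiltration.mono n.le_succ _ (hst n)
  · have hω' : τ ω + 1 ≤ h.phi S ω := hω
    change τ ω < h.phi S ω
    rw [h.phi_eq hS] at hω' ⊢
    have hne : τ ω ≠ ⊤ := fun hc => by simp [hc] at hω'
    exact (ENat.add_one_le_iff hne).1 hω'

theorem ruleClassLE_subset_ruleClass (h : N.IsRealization P lam X) (S : Finset (Fin d)) (α : ℝ) :
    h.ruleClassLE S α ⊆ h.ruleClass S α := fun τ hτ =>
  ⟨hτ.1, (measure_mono fun ω (hω : τ ω < h.phi S ω) => hω.le).trans hτ.2⟩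

theorem measurable_mixOut_comp (h : N.IsRealization P lam X) (S : Finset (Fin d)) {K : Ω → ℕ}
    (hK : Measurable K) : Measurable fun ω => h.mixOut M S (fun j => lam j ω) (K ω) ω := by
  have hg : Measurable fun ω => ((fun j => lam j ω : Fin d → ℕ), K ω) :=
    h.measurable_lamVec.prodMk hK
  have key : ∀ F : (Fin d → ℕ) × ℕ → Ω → ℝ≥0∞, (∀ p, Measurable (F p)) →
      Measurable fun ω => F (fun j => lam j ω, K ω) ω := fun F hF => Measurable.comp_countable hF hg
  exact key (fun p => h.mixOut M S p.1 p.2) fun p => h.measurable_mixOut S p.1 p.2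

/-- Truncated subtraction vanishes off the conditioning event, so conditioning only divides the
unconditional integral by a probability. -/
theorem delay_eq (h : N.IsRealization P lam X) (S : Finset (Fin d)) {τ : Ω → ℕ∞}
    (hτ : Measurable τ) : h.delay S τ =
      (P {ω | h.phi S ω ≤ τ ω})⁻¹ * ∫⁻ ω, ((τ ω - h.phi S ω : ℕ∞) : ℝ≥0∞) ∂P := by
  have hm : MeasurableSet {ω | h.phi S ω ≤ τ ω} := (h.measurable_phi S).prodMk hτ
    (Set.to_countable {p : ℕ∞ × ℕ∞ | p.1 ≤ p.2}).measurableSet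
  rw [delay, ProbabilityTheory.cond, lintegral_smul_measure, smul_eq_mul,
    ← lintegral_indicator hm]
  congr 1
  refine lintegral_congr fun ω => ?_
  by_cases hω : h.phi S ω ≤ τ ω
  · rw [Set.indicator_of_mem (by exact hω)]
  · rw [Set.indicator_of_notMem (by exact hω), tsub_eq_zero_of_le (not_le.1 hω).le]
    simp

variable [IsProbabilityMeasure P]

/-- Upper bound for the unconditional expected delay of the posterior-threshold rule. -/
theorem lintegral_thresholdRule_sub_phi_le (hM : N.BoundedLLR M) (hM0 : 0 ≤ M)
    (h : N.IsRealization P lam X) {S : Finset (Fin d)} (hS : S.Nonempty) {α : ℝ} (hα : 0 < α)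
    (hα1 : α < 1) :
    ∫⁻ ω, ((h.thresholdRule S α ω - h.phi S ω : ℕ∞) : ℝ≥0∞) ∂P ≤
      ENNReal.ofReal ((-Real.log α + h.overheadUpper M S) / (N.priorRate S + N.totalInfo S)) := by
  have hD := hM.rate_pos hM0 hS
  have hst := h.isStoppingTime_thresholdRule S α
  have hone := h.one_le_thresholdRule S α
  have hpath := priorRate_mul_add_score_le hM hM0 h S hα hα1
  set τ := h.thresholdRule S α with hτ
  set D := N.priorRate S + N.totalInfo S with hDdef
  set E : ℝ := (extEdges N.graph).card * M with hE
  have hτm := h.measurable_of_isStoppingTime hst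
  set φ : Ω → ℕ := fun ω => S.inf' hS fun j => lam j ω with hφ
  have hφm : Measurable φ := h.measurable_inf' hS
  -- The truncation makes `delta` bounded and lets Wald's identity apply directly. It is taken at `n
  -- + 1` so that the stopped time is at least `1`.
  have hbound : ∀ n : ℕ, ∫⁻ ω, ((min (τ ω) (n + 1 : ℕ) - h.phi S ω : ℕ∞) : ℝ≥0∞) ∂P ≤
      ENNReal.ofReal ((-Real.log α + h.overheadUpper M S) / D) := by
    intro n
    set K := stoppedTime τ (n + 1) with hK
    have hKm : Measurable K := h.measurable_stoppedTime hst (n + 1)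
    set delta : Ω → ℝ := fun ω => ((K ω - φ ω : ℕ) : ℝ) with hdelta
    have hdm : Measurable delta :=
      (measurable_of_countable fun p : ℕ × ℕ => ((p.1 - p.2 : ℕ) : ℝ)).comp (hKm.prodMk hφm)
    have hd0 : ∀ ω, 0 ≤ delta ω := fun ω => Nat.cast_nonneg _
    have hdi : Integrable delta P := by
      refine Integrable.of_bound (C := ((n + 1 : ℕ) : ℝ)) hdm.aestronglyMeasurable
        (Eventually.of_forall fun ω => ?_)
      rw [Real.norm_of_nonneg (hd0 ω)]
      exact Nat.cast_le.2 ((Nat.sub_le _ _).trans (stoppedTime_le _ _ _))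
    have hVd : ∫⁻ ω, ((min (τ ω) (n + 1 : ℕ) - h.phi S ω : ℕ∞) : ℝ≥0∞) ∂P =
        ∫⁻ ω, ENNReal.ofReal (delta ω) ∂P := by
      refine lintegral_congr fun ω => ?_
      rw [← coe_stoppedTime, h.phi_eq hS, ← ENat.natCast_sub, ENat.toENNReal_coe]
      exact (ENNReal.ofReal_natCast _).symm
    set Y : Ω → ℝ≥0∞ := fun ω => h.mixOut M S (fun j => lam j ω) (K ω) ω with hY
    have hYm : Measurable Y := h.measurable_mixOut_comp S hKm
    have hY1 : ∫⁻ ω, Y ω ∂P ≤ 1 := lintegral_mixOut_le hM hM0 h S hst (n + 1)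
    have hYt : ∫⁻ ω, Y ω ∂P ≠ ∞ := ne_top_of_le_ne_top ENNReal.one_ne_top hY1
    have hYfin : ∀ᵐ ω ∂P, Y ω < ∞ := ae_lt_top hYm hYt
    have hYi : Integrable (fun ω => (Y ω).toReal) P :=
      integrable_toReal_of_lintegral_ne_top hYm.aemeasurable hYt
    have hYI : ∫ ω, (Y ω).toReal ∂P ≤ 1 := by
      rw [integral_toReal hYm.aemeasurable hYfin]
      exact ENNReal.toReal_le_of_le_ofReal zero_le_one (by simpa using hY1)
    set H : Ω → ℝ := fun ω => ∑ j, (-Real.log (1 - N.ρ j) * lam j ω - Real.log (N.ρ j)) with hH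
    have hHi : Integrable H P := integrable_finsetSum _ fun j _ =>
      ((h.integrable_lam j).const_mul _).sub (integrable_const _)
    set Λ : Ω → ℝ := fun ω => 1 + ∑ j, (lam j ω : ℝ) with hΛ
    have hΛi : Integrable Λ P := h.integrable_sum_lam
    set W : Ω → ℝ := fun ω => h.score M (ChangedInside S) (K ω) ω -
      scoreComp N (ChangedInside S fun j => lam j ω) (K ω) with hW
    have hWi : Integrable W P := h.integrable_score_sub hM0 hst (ChangedInside S) (n + 1)
    have hW0 : ∫ ω, W ω ∂P = 0 :=
      integral_score_sub hM hM0 h hst (fun _ _ _ hh => hh.2) (n + 1)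
    have hle : ∀ᵐ ω ∂P, D * delta ω ≤ (-Real.log α + N.priorRate S + 2 * E) + H ω +
        (Y ω).toReal - W ω + (N.priorRate S + E) * Λ ω := by
      filter_upwards [hpath, hYfin] with ω hω hYω
      have hK1 : 1 ≤ K ω := by
        rw [← Nat.cast_le (α := ℕ∞), hK, coe_stoppedTime]
        exact le_min (by simpa using hone ω) (by exact_mod_cast Nat.le_add_left 1 n)
      -- The time `k` just before the truncated rule stops is still below the threshold, while
      -- `score` and `mixOut` are evaluated at `k + 1 = K`, where their means are known.
      obtain ⟨k, hk⟩ : ∃ k, K ω = k + 1 := ⟨K ω - 1, by omega⟩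
      have hkτ : (k : ℕ∞) < τ ω := by
        have h1 : ((k + 1 : ℕ) : ℕ∞) ≤ τ ω := by
          rw [← hk, hK, coe_stoppedTime]; exact min_le_left _ _
        exact lt_of_lt_of_le (by exact_mod_cast Nat.lt_succ_self k) h1
      have h1 := hω k hkτ (by rw [← hk]; exact hYω.ne)
      have h2 := hM.abs_scoreComp_sub_le hM0 hS (fun j => lam j ω)
        (a := ChangedInside S fun j => lam j ω)
        (fun e he t => changedInside_iff he _ t) (fun e he t hh => absurd hh.1 he) (K ω)
      have h3 := (abs_le.1 h2).1
      rw [← hk] at h1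
      have h4 : (K ω : ℝ) = k + 1 := by rw [hk]; push_cast; ring
      have h5 : N.priorRate S * (K ω : ℝ) = N.priorRate S * k + N.priorRate S := by rw [h4]; ring
      simp only [hW, hdelta, hΛ, hY, hH, hφ]
      linarith
    have i1 : Integrable (fun ω => (-Real.log α + N.priorRate S + 2 * E) + H ω) P :=
      (integrable_const _).add hHi
    have i2 : Integrable (fun ω => (-Real.log α + N.priorRate S + 2 * E) + H ω +
      (Y ω).toReal) P := i1.add hYi
    have i3 : Integrable (fun ω => (-Real.log α + N.priorRate S + 2 * E) + H ω +
      (Y ω).toReal - W ω) P := i2.sub hWi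
    have hint := integral_mono_ae (hdi.const_mul D) (i3.add (hΛi.const_mul _)) hle
    simp only [Pi.add_apply] at hint
    rw [integral_const_mul, integral_add i3 (hΛi.const_mul _), integral_sub i2 hWi,
      integral_add i1 hYi, integral_add (integrable_const _) hHi, hW0, integral_const_mul,
      h.integral_sum_lam, integral_const, probReal_univ, one_smul] at hint
    rw [hVd, ← ofReal_integral_eq_lintegral_ofReal hdi (Eventually.of_forall hd0)]
    refine ENNReal.ofReal_le_ofReal ?_
    rw [le_div_iff₀ hD, mul_comm]
    refine hint.trans ?_
    unfold overheadUpper overhead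
    linarith
  -- Monotone convergence removes the truncation; the uniform bound also covers paths on which the
  -- rule might never stop.
  have hlim : Tendsto (fun n : ℕ => ∫⁻ ω, ((min (τ ω) (n + 1 : ℕ) - h.phi S ω : ℕ∞) : ℝ≥0∞) ∂P)
      atTop (𝓝 (∫⁻ ω, ((τ ω - h.phi S ω : ℕ∞) : ℝ≥0∞) ∂P)) := by
    refine lintegral_tendsto_of_tendsto_of_monotone (fun n => ?_)
      (Eventually.of_forall fun ω n n' hnn => ?_) (Eventually.of_forall fun ω => ?_)
    · exact (h.measurable_sub_phi S 
      ((measurable_of_countable fun k : ℕ∞ => min k (n + 1 : ℕ)).comp hτm)).aemeasurable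
    · refine ENat.toENNReal_le.2 (tsub_le_tsub_right (min_le_min_left _ ?_) _)
      exact_mod_cast Nat.succ_le_succ hnn
    · by_cases htop : τ ω = ⊤
      · rw [htop, h.phi_eq hS]
        simp only [min_eq_right le_top]
        have h1 : ((⊤ - (φ ω : ℕ∞) : ℕ∞) : ℝ≥0∞) = ∞ := by
          simp
        have h2 : ∀ n : ℕ, (((n + 1 : ℕ) - (φ ω : ℕ∞) : ℕ∞) : ℝ≥0∞) =
            ((n + 1 - φ ω : ℕ) : ℝ≥0∞) := by
          intro n
          rw [← ENat.natCast_sub, ENat.toENNReal_coe]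
        change Tendsto (fun n : ℕ => (((n + 1 : ℕ) - (φ ω : ℕ∞) : ℕ∞) : ℝ≥0∞)) atTop
          (𝓝 ((⊤ - (φ ω : ℕ∞) : ℕ∞) : ℝ≥0∞))
        rw [h1]
        simp_rw [h2]
        refine ENNReal.tendsto_nat_nhds_top.comp ?_
        exact (tendsto_sub_atTop_nat (φ ω)).comp (tendsto_add_atTop_nat 1)
      · obtain ⟨k, hk⟩ := ENat.ne_top_iff_exists.1 htop
        refine tendsto_const_nhds.congr' ?_
        filter_upwards [eventually_ge_atTop k] with n hn
        rw [min_eq_left]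
        rw [← hk]
        exact_mod_cast hn.trans n.le_succ
  exact le_of_tendsto' hlim hbound

theorem ofReal_le_measure_phi_le (h : N.IsRealization P lam X) {S : Finset (Fin d)} {α : ℝ}
    (hα : 0 < α) {τ : Ω → ℕ∞} (hτ : τ ∈ h.ruleClass S α) :
    ENNReal.ofReal (1 - α) ≤ P {ω | h.phi S ω ≤ τ ω} := by
  have hm : MeasurableSet {ω | τ ω < h.phi S ω} :=
    (h.measurable_of_isStoppingTime hτ.1).prodMk (h.measurable_phi S)
    (Set.to_countable {p : ℕ∞ × ℕ∞ | p.1 < p.2}).measurableSet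
  have hc : {ω | h.phi S ω ≤ τ ω} = {ω | τ ω < h.phi S ω}ᶜ := by ext ω; simp
  rw [hc, prob_compl_eq_one_sub hm, ENNReal.ofReal_sub _ hα.le, ENNReal.ofReal_one]
  exact tsub_le_tsub_left hτ.2 1

theorem le_delay (h : N.IsRealization P lam X) (S : Finset (Fin d)) {τ : Ω → ℕ∞}
    (hτ : Measurable τ) : ∫⁻ ω, ((τ ω - h.phi S ω : ℕ∞) : ℝ≥0∞) ∂P ≤ h.delay S τ := by
  rw [h.delay_eq S hτ]
  exact le_mul_of_one_le_left' (ENNReal.one_le_inv.2 prob_le_one)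

theorem delay_le (h : N.IsRealization P lam X) {S : Finset (Fin d)} {α : ℝ} (hα : 0 < α)
    {τ : Ω → ℕ∞} (hτ : τ ∈ h.ruleClass S α) :
    h.delay S τ ≤ (∫⁻ ω, ((τ ω - h.phi S ω : ℕ∞) : ℝ≥0∞) ∂P) / ENNReal.ofReal (1 - α) := by
  rw [h.delay_eq S (h.measurable_of_isStoppingTime hτ.1), mul_comm, div_eq_mul_inv]
  gcongr
  exact h.ofReal_le_measure_phi_le hα hτ

theorem lintegral_add_one_sub_phi_le (h : N.IsRealization P lam X) (S : Finset (Fin d))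
    (τ : Ω → ℕ∞) : ∫⁻ ω, ((τ ω + 1 - h.phi S ω : ℕ∞) : ℝ≥0∞) ∂P ≤
      ∫⁻ ω, ((τ ω - h.phi S ω : ℕ∞) : ℝ≥0∞) ∂P + 1 := by
  calc _ ≤ ∫⁻ ω, (((τ ω - h.phi S ω : ℕ∞) : ℝ≥0∞) + 1) ∂P := by
        refine lintegral_mono fun ω => ?_
        rw [← ENat.toENNReal_one, ← ENat.toENNReal_add, ENat.toENNReal_le]
        exact add_tsub_le_tsub_add
    _ = _ := by rw [lintegral_add_right _ measurable_const]; simp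

end IsRealization

end ChangePointNetwork

theorem theorem1 {d : ℕ} {𝒳 : Type*} [MeasurableSpace 𝒳] (N : ChangePointNetwork d 𝒳)
    (M : ℝ) (hM : N.BoundedLLR M)
    {Ω : Type*} [MeasurableSpace Ω] (P : Measure Ω) [IsProbabilityMeasure P]
    (lam : Fin d → Ω → ℕ) (X : Finset (Fin d) → ℕ → Ω → 𝒳) (h : N.IsRealization P lam X)
    (S : Finset (Fin d)) (hS : S.Nonempty) :
    (∀ α : ℝ, 0 < α → α < 1 → h.thresholdRule S α ∈ h.ruleClass S α) ∧
    Tendsto (fun α : ℝ => h.delay S (h.thresholdRule S α) /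
        ENNReal.ofReal (|Real.log α| / (N.priorRate S + N.totalInfo S))) (𝓝[>] 0) (𝓝 1) ∧
    Tendsto (fun α : ℝ => (⨅ τ ∈ h.ruleClass S α, h.delay S τ) /
        ENNReal.ofReal (|Real.log α| / (N.priorRate S + N.totalInfo S))) (𝓝[>] 0) (𝓝 1) ∧
    Tendsto (fun α : ℝ => (⨅ τ ∈ h.ruleClassLE S α, h.delay S τ) /
        ENNReal.ofReal (|Real.log α| / (N.priorRate S + N.totalInfo S))) (𝓝[>] 0) (𝓝 1) := by
  -- The sign of `M` is not assumed, whereas the estimates need a nonnegative bound.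
  have hM' : N.BoundedLLR |M| := hM.mono (le_abs_self M)
  have hM0 : 0 ≤ |M| := abs_nonneg M
  have hD := hM'.rate_pos hM0 hS
  have hmem : ∀ α : ℝ, 0 < α → h.thresholdRule S α ∈ h.ruleClass S α :=
    fun α hα => h.thresholdRule_mem_ruleClass S hα
  have hlow : ∀ α : ℝ, 0 < α → ∀ τ ∈ h.ruleClass S α,
      ENNReal.ofReal ((-Real.log α - h.overhead |M| S) / (N.priorRate S + N.totalInfo S)) ≤
        h.delay S τ := fun α hα τ hτ =>
    (ChangePointNetwork.IsRealization.le_lintegral_sub_phi hM' hM0 h hS hα hτ).trans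
      (h.le_delay S (h.measurable_of_isStoppingTime hτ.1))
  have hupp : ∀ α : ℝ, 0 < α → α < 1 → h.delay S (h.thresholdRule S α) ≤
      ENNReal.ofReal ((-Real.log α + h.overheadUpper |M| S) / (N.priorRate S + N.totalInfo S)) /
        ENNReal.ofReal (1 - α) := fun α hα hα1 =>
    (h.delay_le hα (hmem α hα)).trans (ENNReal.div_le_div_right
      (ChangePointNetwork.IsRealization.lintegral_thresholdRule_sub_phi_le
      hM' hM0 h hS hα hα1) _)
  refine ⟨fun α hα _ => hmem α hα, ?_, ?_, ?_⟩
  · exact ENNReal.tendsto_div_ofReal_abs_log hD (fun α hα _ => hlow α hα _ (hmem α hα)) hupp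
  · exact ENNReal.tendsto_div_ofReal_abs_log hD (fun α hα _ => le_iInf₂ (hlow α hα))
      fun α hα hα1 => (iInf₂_le _ (hmem α hα)).trans (hupp α hα hα1)
  · refine ENNReal.tendsto_div_ofReal_abs_log
      -- The summand `D` pays for the extra time unit of `τ_S + 1`, and the absolute value makes the
      -- numerator nonnegative so that `ENNReal.ofReal` is additive.
      (C' := |h.overheadUpper |M| S| + (N.priorRate S + N.totalInfo S)) hD
      (fun α hα _ => le_iInf₂ fun τ hτ => hlow α hα τ (h.ruleClassLE_subset_ruleClass S α hτ))
      fun α hα hα1 => ?_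
    have hLE := h.add_one_mem_ruleClassLE hS (hmem α hα)
    refine (iInf₂_le _ hLE).trans ((h.delay_le hα
      (h.ruleClassLE_subset_ruleClass S α hLE)).trans (ENNReal.div_le_div_right ?_ _))
    refine (h.lintegral_add_one_sub_phi_le S _).trans ?_
    refine (add_le_add_left (ChangePointNetwork.IsRealization.lintegral_thresholdRule_sub_phi_le
      hM' hM0 h hS hα hα1) 1).trans ?_
    have hsplit : (-Real.log α + (|h.overheadUpper |M| S| + (N.priorRate S + N.totalInfo S))) /
        (N.priorRate S + N.totalInfo S) =
        (-Real.log α + |h.overheadUpper |M| S|) / (N.priorRate S + N.totalInfo S) + 1 := by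
      rw [← add_assoc, add_div _ (N.priorRate S + N.totalInfo S), div_self hD.ne']
    have hL : 0 < -Real.log α := by linarith [Real.log_neg hα hα1]
    rw [hsplit, ENNReal.ofReal_add (by positivity) zero_le_one, ENNReal.ofReal_one]
    gcongr
    exact le_abs_self _
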